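/- Let $d\ge 1$. An $m$-covector $\varphi\in\bigwedge^m\mathbb R^d$ carries the comass norm $\|\varphi\|=\sup\{\langle \xi,\varphi\rangle:\ \xi \text{ a simple } m\text{-vector},\ |\xi|\le 1\}$, and for an $m$-form $\omega$ on $\mathbb R^d$ and $Y\subset\mathbb R^d$ we put $\|\omega\|_{\infty,Y}=\sup_{y\in Y}\|\omega(y)\|$ and $\|\omega\|_\infty=\|\omega\|_{\infty,\mathbb R^d}$. Let $\mathscr D^m(\mathbb R^d)$ be the space of compactly supported smooth $m$-forms; its topological dual is the space of $m$-currents. For an $m$-current $T$ let $$\mathbf M(T)=\sup\{T(\varphi): \|\varphi\|_\infty\le 1\},\quad \mathbf N(T)=\mathbf M(T)+\mathbf M(\partial T),\quad \mathbf F(T)=\sup\{T(\varphi):\max\{\|\varphi\|_\infty,\|d\varphi\|_\infty\}\le 1\},$$ where $\varphi$ ranges over $\mathscr D^m(\mathbb R^d)$, $\partial T(\psi)=T(d\psi)$, and $\partial T=0$ if $m=0$. For a compact set $K\subset\mathbb R^d$ let $\mathbf N_m(K)$ be the space of $m$-currents $T$ with $\mathbf N(T)<\infty$ and $\operatorname{spt}T\subset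 K$. For a linear functional $\omega$ on $\mathbf N_m(K)$ and $0<\alpha\le 1$ let $$\|\omega\|_{\mathbf{CH}^{m,\alpha}(K)}=\inf\{C\ge 0: |\omega(T)|\le C\,\mathbf N(T)^{1-\alpha}\mathbf F(T)^{\alpha}\text{ for all }T\in\mathbf N_m(K)\}\in[0,\infty].$$ A smooth $m$-form $\omega$ on $\mathbb R^d$ is regarded as the functional $T\mapsto T(\omega)$ on $\mathbf N_m(K)$, where $T(\omega)$ means $T(\chi\omega)$ for any compactly supported smooth function $\chi$ that equals $1$ in a neighbourhood of $K$. Consider compact sets $K\subset\mathbb R^d$ such that (A) every nonempty relatively open subset of $K$ has positive Lebesgue measure, and (B) $K$ is a $1$-Lipschitz retract of $\mathbb R^d$. (1) For every $m\ge 0$, every $\omega\in C^\infty(\mathbb R^d;\bigwedge^m\mathbb R^d)$ and every compact $K$ satisfying (A) and (B), $$\|\omega\|_{\mathbf{CH}^{m,1}(K)}=\max\{\|\omega\|_{\infty,K},\ \|d\omega\|_{\infty,K}\}.$$ (2) For all $m,m'\ge 0$ there is a constant $C\ge 0$, depending only on $d$, $m$ and $m'$, such that for all $\omega\in C^\infty(\mathbb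 R^d;\bigwedge^m\mathbb R^d)$, all $\eta\in C^\infty(\mathbb R^d;\bigwedge^{m'}\mathbb R^d)$ and every compact $K$ satisfying (A) and (B), $$\|\omega\wedge\eta\|_{\mathbf{CH}^{m+m',1}(K)}\le C\,\|\omega\|_{\mathbf{CH}^{m,1}(K)}\,\|\eta\|_{\mathbf{CH}^{m',1}(K)}.$$ -/

import Mathlib

open scoped NNReal ENNReal Topology Distributions
open TopologicalSpace

noncomputable section

namespace FracCharge

/-! ### Covectors -/

/-- The ambient space `ℝ^d`, with its Euclidean norm and Lebesgue measure. -/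
abbrev Space (d : ℕ) := EuclideanSpace ℝ (Fin d)

/-- The space `⋀^m ℝ^d` of `m`-covectors, i.e. alternating `m`-linear forms on `ℝ^d`. -/
abbrev Covector (d m : ℕ) := Space d [⋀^Fin m]→L[ℝ] ℝ

/-- The comass `sup {⟨ξ, φ⟩ : ξ a simple m-vector, |ξ| ≤ 1}` of an `m`-covector `φ`. A simple
`m`-vector is `ξ = v₁ ∧ ⋯ ∧ v_m`; its length `|ξ|` is the one of the Euclidean space `⋀_m ℝ^d`,
and `⟨ξ, φ⟩ = φ v`. -/
def comass {d m : ℕ} (φ : Covector d m) : ℝ≥0∞ :=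
  ⨆ (v : Fin m → Space d) (_ : ‖exteriorPower.ιMulti ℝ m v‖ ≤ 1), ‖φ v‖ₑ

/-- `‖ω‖_{∞, Y}`, the supremum over `Y` of the comass of `ω`. -/
def supComass {d m : ℕ} (Y : Set (Space d)) (ω : Space d → Covector d m) : ℝ≥0∞ :=
  ⨆ y ∈ Y, comass (ω y)

/-! ### The wedge product of covectors

The product is normalised by
`(φ ∧ ψ)(v₁, …, v_{m+n}) = ∑ sign σ • φ(v_{σ 1}, …, v_{σ m}) ψ(v_{σ (m+1)}, …, v_{σ (m+n)})`,
the sum being over all `(m, n)`-shuffles `σ`; for instance `(dx₁ ∧ dx₂)(e₁, e₂) = 1`. -/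

/-- The wedge product as an (algebraic) alternating map. -/
def wedgeAlt {d m n : ℕ} (φ : Covector d m) (ψ : Covector d n) :
    Space d [⋀^Fin (m + n)]→ₗ[ℝ] ℝ :=
  ((LinearMap.mul' ℝ ℝ).compAlternatingMap
    (φ.toAlternatingMap.domCoprod ψ.toAlternatingMap)).domDomCongr finSumFinEquiv

theorem wedgeAlt_add_left {d m n : ℕ} (φ φ' : Covector d m) (ψ : Covector d n) :
    wedgeAlt (φ + φ') ψ = wedgeAlt φ ψ + wedgeAlt φ' ψ := by
  have h : (φ + φ').toAlternatingMap = φ.toAlternatingMap + φ'.toAlternatingMap := rfl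
  ext v
  simp only [wedgeAlt, h, ← AlternatingMap.domCoprod'_apply, TensorProduct.add_tmul, map_add]
  simp

theorem wedgeAlt_smul_left {d m n : ℕ} (c : ℝ) (φ : Covector d m) (ψ : Covector d n) :
    wedgeAlt (c • φ) ψ = c • wedgeAlt φ ψ := by
  have h : (c • φ).toAlternatingMap = c • φ.toAlternatingMap := rfl
  ext v
  simp only [wedgeAlt, h, ← AlternatingMap.domCoprod'_apply, ← TensorProduct.smul_tmul', map_smul]
  simp

theorem wedgeAlt_add_right {d m n : ℕ} (φ : Covector d m) (ψ ψ' : Covector d n) :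
    wedgeAlt φ (ψ + ψ') = wedgeAlt φ ψ + wedgeAlt φ ψ' := by
  have h : (ψ + ψ').toAlternatingMap = ψ.toAlternatingMap + ψ'.toAlternatingMap := rfl
  ext v
  simp only [wedgeAlt, h, ← AlternatingMap.domCoprod'_apply, TensorProduct.tmul_add, map_add]
  simp

theorem wedgeAlt_smul_right {d m n : ℕ} (c : ℝ) (φ : Covector d m) (ψ : Covector d n) :
    wedgeAlt φ (c • ψ) = c • wedgeAlt φ ψ := by
  have h : (c • ψ).toAlternatingMap = c • ψ.toAlternatingMap := rfl
  ext v
  simp only [wedgeAlt, h, ← AlternatingMap.domCoprod'_apply, TensorProduct.tmul_smul, map_smul]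
  simp

theorem norm_wedgeAlt_le {d m n : ℕ} (φ : Covector d m) (ψ : Covector d n)
    (v : Fin (m + n) → Space d) :
    ‖wedgeAlt φ ψ v‖ ≤
      (Fintype.card (Equiv.Perm.ModSumCongr (Fin m) (Fin n)) * ‖φ‖ * ‖ψ‖) * ∏ i, ‖v i‖ := by
  have key : ∀ σ : Equiv.Perm.ModSumCongr (Fin m) (Fin n),
      ‖LinearMap.mul' ℝ ℝ (AlternatingMap.domCoprod.summand φ.toAlternatingMap
        ψ.toAlternatingMap σ (fun i => v (finSumFinEquiv i)))‖ ≤ ‖φ‖ * ‖ψ‖ * ∏ i, ‖v i‖ := by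
    intro σ
    induction σ using Quotient.inductionOn' with | _ σ
    set w : Fin m ⊕ Fin n → Space d := fun i => v (finSumFinEquiv (σ i)) with hw
    have hprod : ∏ i, ‖v i‖ = (∏ i, ‖w (Sum.inl i)‖) * ∏ i, ‖w (Sum.inr i)‖ := by
      rw [← Fintype.prod_sum_type (fun i => ‖w i‖), hw]
      exact (Equiv.prod_comp (σ.trans finSumFinEquiv) (fun i => ‖v i‖)).symm
    have h1 := φ.le_opNorm (fun i => w (Sum.inl i))
    have h2 := ψ.le_opNorm (fun i => w (Sum.inr i))
    have h3 : ‖LinearMap.mul' ℝ ℝ (AlternatingMap.domCoprod.summand φ.toAlternatingMap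
        ψ.toAlternatingMap (Quotient.mk'' σ) (fun i => v (finSumFinEquiv i)))‖
        = ‖φ (fun i => w (Sum.inl i))‖ * ‖ψ (fun i => w (Sum.inr i))‖ := by
      rw [AlternatingMap.domCoprod.summand_mk'']
      rcases Int.units_eq_one_or (Equiv.Perm.sign σ) with h | h <;> rw [h] <;> simp [hw]
    rw [h3, hprod]
    calc _ ≤ (‖φ‖ * ∏ i, ‖w (Sum.inl i)‖) * (‖ψ‖ * ∏ i, ‖w (Sum.inr i)‖) := by gcongr
      _ = _ := by ring
  have hsum : wedgeAlt φ ψ v = ∑ σ : Equiv.Perm.ModSumCongr (Fin m) (Fin n),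
      LinearMap.mul' ℝ ℝ (AlternatingMap.domCoprod.summand φ.toAlternatingMap
        ψ.toAlternatingMap σ (fun i => v (finSumFinEquiv i))) := by
    simp [wedgeAlt, AlternatingMap.domCoprod_apply, Function.comp_def]
  rw [hsum]
  refine (norm_sum_le_of_le _ (fun σ _ => key σ)).trans (le_of_eq ?_)
  simp
  ring

/-- The wedge product of covectors. -/
def wedge {d m n : ℕ} (φ : Covector d m) (ψ : Covector d n) : Covector d (m + n) :=
  (wedgeAlt φ ψ).mkContinuous _ (norm_wedgeAlt_le φ ψ)

/-- The wedge product as a continuous bilinear map. -/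
def wedgeCLM (d m n : ℕ) : Covector d m →L[ℝ] Covector d n →L[ℝ] Covector d (m + n) :=
  LinearMap.mkContinuous₂
    (LinearMap.mk₂ ℝ wedge
      (fun φ φ' ψ => by
        ext v; exact congrArg (fun f => f v) (wedgeAlt_add_left φ φ' ψ))
      (fun c φ ψ => by
        ext v; exact congrArg (fun f => f v) (wedgeAlt_smul_left c φ ψ))
      (fun φ ψ ψ' => by
        ext v; exact congrArg (fun f => f v) (wedgeAlt_add_right φ ψ ψ'))
      (fun c φ ψ => by
        ext v; exact congrArg (fun f => f v) (wedgeAlt_smul_right c φ ψ)))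
    (Fintype.card (Equiv.Perm.ModSumCongr (Fin m) (Fin n)))
    (fun φ ψ => ContinuousAlternatingMap.opNorm_le_bound _ (by positivity)
      (norm_wedgeAlt_le φ ψ))

/-! ### Smooth forms, test forms and currents -/

/-- Smooth `m`-forms on `ℝ^d`. -/
structure SmoothForm (d m : ℕ) where
  /-- The underlying map. -/
  toFun : Space d → Covector d m
  smooth : ContDiff ℝ ((⊤ : ℕ∞) : WithTop ℕ∞) toFun

/-- The pointwise wedge product of smooth forms. -/
def SmoothForm.wedge {d m n : ℕ} (ω : SmoothForm d m) (η : SmoothForm d n) :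
    SmoothForm d (m + n) where
  toFun x := FracCharge.wedge (ω.toFun x) (η.toFun x)
  smooth := by
    change ContDiff ℝ _ (fun x => wedgeCLM d m n (ω.toFun x) (η.toFun x))
    exact ((wedgeCLM d m n).contDiff.comp ω.smooth).clm_apply η.smooth

/-- The space `𝒟^m(ℝ^d)` of compactly supported smooth `m`-forms, with its LF topology. -/
abbrev TestForm (d m : ℕ) := 𝓓((⊤ : Opens (Space d)), Covector d m)

/-- The exterior derivative on test forms. -/
def testD (d m : ℕ) : TestForm d m →L[ℝ] TestForm d (m + 1) :=
  (TestFunction.postcompCLM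
    (ContinuousAlternatingMap.alternatizeUncurryFinCLM (n := m) ℝ (Space d) ℝ)).comp
    (TestFunction.fderivCLM ℝ ⊤ ⊤)

theorem testD_apply {d m : ℕ} (φ : TestForm d m) (x : Space d) :
    testD d m φ x = extDeriv φ x := by
  simp [testD, extDeriv]

/-- The space `𝒟_m(ℝ^d)` of `m`-dimensional currents in `ℝ^d`. -/
abbrev Current (d m : ℕ) := TestForm d m →L[ℝ] ℝ

/-- The boundary of a current of positive dimension, `∂T (φ) = T (dφ)`. -/
def Current.boundary {d m : ℕ} (T : Current d (m + 1)) : Current d m := T.comp (testD d m)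

/-- The support of a current. -/
def Current.spt {d m : ℕ} (T : Current d m) : Set (Space d) := Distribution.dsupport T

/-- The mass `𝐌(T) = sup {T(φ) : ‖φ‖_∞ ≤ 1}`. -/
def Current.mass {d m : ℕ} (T : Current d m) : ℝ≥0∞ :=
  ⨆ (φ : TestForm d m) (_ : supComass Set.univ φ ≤ 1), ‖T φ‖ₑ

/-- The mass of the boundary; a `0`-dimensional current has zero boundary. -/
def Current.boundaryMass {d : ℕ} : {m : ℕ} → Current d m → ℝ≥0∞
  | 0, _ => 0
  | _ + 1, T => T.boundary.mass

/-- The normal mass `𝐍(T) = 𝐌(T) + 𝐌(∂T)`. -/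
def Current.normalMass {d m : ℕ} (T : Current d m) : ℝ≥0∞ := T.mass + T.boundaryMass

/-- The flat norm `𝐅(T) = sup {T(φ) : max {‖φ‖_∞, ‖dφ‖_∞} ≤ 1}`. -/
def Current.flatNorm {d m : ℕ} (T : Current d m) : ℝ≥0∞ :=
  ⨆ (φ : TestForm d m)
    (_ : max (supComass Set.univ φ) (supComass Set.univ (extDeriv φ)) ≤ 1), ‖T φ‖ₑ

/-! ### Normal currents supported in a compact set -/

theorem Current.mass_zero {d m : ℕ} : (0 : Current d m).mass = 0 := by
  simp [Current.mass]

theorem Current.mass_add_le {d m : ℕ} (S T : Current d m) :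
    (S + T).mass ≤ S.mass + T.mass := by
  refine iSup₂_le fun φ hφ => ?_
  calc ‖(S + T) φ‖ₑ ≤ ‖S φ‖ₑ + ‖T φ‖ₑ := enorm_add_le _ _
    _ ≤ _ := add_le_add (le_iSup₂ (f := fun (φ : TestForm d m) _ => ‖S φ‖ₑ) φ hφ)
      (le_iSup₂ (f := fun (φ : TestForm d m) _ => ‖T φ‖ₑ) φ hφ)

theorem Current.mass_smul_le {d m : ℕ} (c : ℝ) (T : Current d m) :
    (c • T).mass ≤ ‖c‖ₑ * T.mass := by
  refine iSup₂_le fun φ hφ => ?_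
  calc ‖(c • T) φ‖ₑ = ‖c‖ₑ * ‖T φ‖ₑ := enorm_smul c (T φ)
    _ ≤ _ := by
      gcongr
      exact le_iSup₂ (f := fun (φ : TestForm d m) _ => ‖T φ‖ₑ) φ hφ

theorem Current.normalMass_zero {d m : ℕ} : (0 : Current d m).normalMass = 0 := by
  cases m with
  | zero => simp [Current.normalMass, Current.boundaryMass, Current.mass_zero]
  | succ m =>
    have h : (0 : Current d (m + 1)).boundary = 0 := rfl
    simp [Current.normalMass, Current.boundaryMass, Current.mass_zero, h]

theorem Current.normalMass_add_le {d m : ℕ} (S T : Current d m) :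
    (S + T).normalMass ≤ S.normalMass + T.normalMass := by
  have h : (S + T).boundaryMass ≤ S.boundaryMass + T.boundaryMass := by
    cases m with
    | zero => simp [Current.boundaryMass]
    | succ m => exact Current.mass_add_le S.boundary T.boundary
  calc (S + T).normalMass ≤ (S.mass + T.mass) + (S.boundaryMass + T.boundaryMass) :=
        add_le_add (Current.mass_add_le S T) h
    _ = _ := by simp only [Current.normalMass]; ring

theorem Current.normalMass_smul_le {d m : ℕ} (c : ℝ) (T : Current d m) :
    (c • T).normalMass ≤ ‖c‖ₑ * T.normalMass := by
  have h : (c • T).boundaryMass ≤ ‖c‖ₑ * T.boundaryMass := by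
    cases m with
    | zero => simp [Current.boundaryMass]
    | succ m => exact Current.mass_smul_le c T.boundary
  calc (c • T).normalMass ≤ ‖c‖ₑ * T.mass + ‖c‖ₑ * T.boundaryMass :=
        add_le_add (Current.mass_smul_le c T) h
    _ = _ := by simp only [Current.normalMass]; ring

/-- The space `𝐍_m(K)` of normal `m`-currents supported in the compact set `K`. -/
def normalCurrents {d : ℕ} (m : ℕ) (K : Compacts (Space d)) : Submodule ℝ (Current d m) where
  carrier := {T | T.normalMass < ∞ ∧ T.spt ⊆ K}
  zero_mem' := by
    refine ⟨by simp [Current.normalMass_zero], fun x hx => ?_⟩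
    by_contra
    refine (Distribution.notMem_dsupport_iff x).2 ⟨Set.univ, ?_, isOpen_univ, trivial⟩ hx
    intro u _
    rfl
  add_mem' := by
    rintro S T ⟨hS, hS'⟩ ⟨hT, hT'⟩
    refine ⟨(Current.normalMass_add_le S T).trans_lt (ENNReal.add_lt_top.2 ⟨hS, hT⟩),
      fun x hx => ?_⟩
    by_contra hxK
    obtain ⟨s, hs, hso, hxs⟩ := (Distribution.notMem_dsupport_iff x).1 (fun h => hxK (hS' h))
    obtain ⟨t, ht, hto, hxt⟩ := (Distribution.notMem_dsupport_iff x).1 (fun h => hxK (hT' h))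
    refine (Distribution.notMem_dsupport_iff x).2 ⟨s ∩ t, ?_, hso.inter hto, hxs, hxt⟩ hx
    intro u hu
    have h1 : S u = 0 := hs u (hu.trans Set.inter_subset_left)
    have h2 : T u = 0 := ht u (hu.trans Set.inter_subset_right)
    change S u + T u = 0
    rw [h1, h2, add_zero]
  smul_mem' := by
    rintro c T ⟨hT, hT'⟩
    refine ⟨(Current.normalMass_smul_le c T).trans_lt (ENNReal.mul_lt_top (by simp) hT),
      fun x hx => ?_⟩
    by_contra hxK
    obtain ⟨t, ht, hto, hxt⟩ := (Distribution.notMem_dsupport_iff x).1 (fun h => hxK (hT' h))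
    refine (Distribution.notMem_dsupport_iff x).2 ⟨t, ?_, hto, hxt⟩ hx
    intro u hu
    have h2 : T u = 0 := ht u hu
    change c • T u = 0
    rw [h2, smul_zero]

/-! ### Charges and fractional norms -/

/-- The `α`-fractional norm `‖ω‖_{𝐂𝐇^{m, α}(K)}` of a linear functional `ω` on `𝐍_m(K)`, that is
`inf {C ≥ 0 : |ω(T)| ≤ C 𝐍(T)^(1 - α) 𝐅(T)^α for all T ∈ 𝐍_m(K)}`, with value `∞` if there is no
such constant `C`. -/
def fracNorm {d m : ℕ} {K : Compacts (Space d)} (α : ℝ) (ω : normalCurrents m K →ₗ[ℝ] ℝ) :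
    ℝ≥0∞ :=
  ⨅ (C : ℝ≥0) (_ : ∀ T : normalCurrents m K,
    ‖ω T‖ₑ ≤ C * T.1.normalMass ^ (1 - α) * T.1.flatNorm ^ α), (C : ℝ≥0∞)

theorem exists_cutoff {d : ℕ} (K : Compacts (Space d)) :
    ∃ χ : 𝓓((⊤ : Opens (Space d)), ℝ), ∀ᶠ x in 𝓝ˢ (K : Set (Space d)), χ x = 1 := by
  obtain ⟨L, hL, hKL⟩ := exists_compact_superset K.isCompact
  obtain ⟨f, hf1, hf0, -⟩ := exists_contMDiffMap_one_nhds_of_subset_interior (n := ⊤)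
    (modelWithCornersSelf ℝ (Space d)) K.isCompact.isClosed hKL
  have hs : tsupport f ⊆ L := by
    refine closure_minimal (fun x hx => ?_) hL.isClosed
    by_contra hxL
    exact hx (hf0 x hxL)
  exact ⟨⟨f, f.contMDiff.contDiff, hL.of_isClosed_subset (isClosed_tsupport _) hs,
    fun _ _ => trivial⟩, hf1⟩

/-- A smooth compactly supported function which is `1` in a neighbourhood of `K`. -/
def cutoff {d : ℕ} (K : Compacts (Space d)) : 𝓓((⊤ : Opens (Space d)), ℝ) :=
  (exists_cutoff K).choose

theorem cutoff_eq_one {d : ℕ} (K : Compacts (Space d)) :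
    ∀ᶠ x in 𝓝ˢ (K : Set (Space d)), cutoff K x = 1 :=
  (exists_cutoff K).choose_spec

/-- The test form `χ ω`, where `χ` is the cutoff of `K`. -/
def SmoothForm.cut {d m : ℕ} (ω : SmoothForm d m) (K : Compacts (Space d)) : TestForm d m where
  toFun x := cutoff K x • ω.toFun x
  contDiff' := (cutoff K).contDiff.smul ω.smooth
  hasCompactSupport' := (cutoff K).hasCompactSupport.smul_right
  tsupport_subset' := fun _ _ => trivial

/-- A smooth form `ω` regarded as a charge over `K`, that is the functional `T ↦ T(ω)` on
`𝐍_m(K)`. As `ω` need not have compact support, `T(ω)` means `T(χ ω)` where `χ` is a cutoff equal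
to `1` near `K ⊇ spt T`; this does not depend on the cutoff. -/
def SmoothForm.charge {d m : ℕ} (ω : SmoothForm d m) (K : Compacts (Space d)) :
    normalCurrents m K →ₗ[ℝ] ℝ where
  toFun T := T.1 (ω.cut K)
  map_add' _ _ := rfl
  map_smul' _ _ := rfl

/-! ### Assumptions on the compact set -/

/-- Every nonempty (relatively) open subset of `K` has positive Lebesgue measure. -/
def OpenSubsetsPos {d : ℕ} (K : Set (Space d)) : Prop :=
  ∀ U : Set (Space d), IsOpen U → (U ∩ K).Nonempty → 0 < MeasureTheory.volume (U ∩ K)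

/-- `K` is a `1`-Lipschitz retract of `ℝ^d`. -/
def IsOneLipschitzRetract {d : ℕ} (K : Set (Space d)) : Prop :=
  ∃ ρ : Space d → Space d, LipschitzWith 1 ρ ∧ (∀ x, ρ x ∈ K) ∧ ∀ x ∈ K, ρ x = x

end FracCharge

end

noncomputable section

namespace FracCharge

/-! ### The comass is the operator norm -/

/-! For `α = 1` the normal mass disappears, and the norm of `ω` is the best `C` in `|T(ω)| ≤ C
𝐅(T)`. Everything rests on (A) and (B) forcing `K` to be convex with nonempty interior, so that the
interior is dense in `K`.

Lower bound (`max_supComass_le`): smear a simple vector over a small ball inside `K`. The resulting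
current `S` satisfies `𝐅(S) ≤ 𝐌(S)` and `𝐅(∂S) ≤ 𝐌(S)`, while `S(ω)` and `∂S(ω)` are averages of `ω`
and `dω`; shrinking the ball gives the pointwise bounds.

Upper bound (`norm_apply_cut_le`): `𝐅(T)` only sees forms bounded on all of `ℝ^d`, whereas `ω` is
controlled on `K` alone. Let `f` be a homothety of ratio `c < 1` about an interior point, followed
by a mollified retraction. It is smooth, `1`-Lipschitz and maps `ℝ^d` into `K`, so `f^*ω` and `d
f^*ω = f^*dω` obey globally the bounds of `ω` and `dω` on `K`. A cutoff with tiny gradient makes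
`f^*ω` a test form. Near `K` it is `ω` pulled back by the homothety, which tends uniformly to `ω` as
`c → 1`; the error is paid with `𝐌(T) < ∞`.

Part (2) follows from (1) and pointwise bounds on `ω ∧ η` and `d(ω ∧ η)`. The latter must involve
only `dω` and `dη`, not full derivatives; this is obtained by comparing antisymmetrisations. Comass
estimates become operator norm estimates through `comass_eq_enorm`. -/

theorem _root_.AlternatingMap.map_update_of_mem_span {R M N ι : Type*} [CommRing R]
    [AddCommGroup M] [AddCommGroup N] [Module R M] [Module R N] [DecidableEq ι]
    (f : M [⋀^ι]→ₗ[R] N) (v : ι → M) (k : ι) {x : M}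
    (hx : x ∈ Submodule.span R (v '' {k}ᶜ)) : f (Function.update v k x) = 0 := by
  induction hx using Submodule.span_induction with
  | mem x h =>
    obtain ⟨j, hj, rfl⟩ := h
    exact f.map_update_self v (fun h => hj (by simp [h]))
  | zero => exact f.map_coord_zero k (by simp)
  | add x y _ _ hx hy => rw [f.map_update_add, hx, hy, add_zero]
  | smul c x _ hx => rw [f.map_update_smul, hx, smul_zero]

theorem _root_.AlternatingMap.map_gramSchmidt {E N : Type*} [NormedAddCommGroup E]
    [InnerProductSpace ℝ E] [AddCommGroup N] [Module ℝ N] {m : ℕ}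
    (f : E [⋀^Fin m]→ₗ[ℝ] N) (v : Fin m → E) :
    f (InnerProductSpace.gramSchmidt ℝ v) = f v := by
  classical
  set u := InnerProductSpace.gramSchmidt ℝ v with hu
  -- The vectors are replaced one at a time: the `k`-th Gram–Schmidt vector differs from `v k` by a
  -- combination of the earlier ones, which are already in the family and so contribute nothing.
  have key : ∀ k : ℕ, k ≤ m → f (fun i => if (i : ℕ) < k then u i else v i) = f v := by
    intro k hk
    induction k with
    | zero => simp
    | succ k ih =>
      rw [← ih (Nat.le_of_succ_le hk)]
      set w : Fin m → E := fun i => if (i : ℕ) < k then u i else v i with hw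
      set j : Fin m := ⟨k, hk⟩ with hj
      have hupd : (fun i : Fin m => if (i : ℕ) < k + 1 then u i else v i)
          = Function.update w j (u j) := by
        funext i
        by_cases hij : i = j
        · subst hij; simp [hj]
        · have : (i : ℕ) ≠ k := fun h => hij (Fin.ext h)
          rw [Function.update_of_ne hij, hw]
          have : (i : ℕ) < k + 1 ↔ (i : ℕ) < k := by omega
          simp [this]
      have hwj : w j = v j := by simp [hw, hj]
      have hsub : u j - v j ∈ Submodule.span ℝ (w '' {j}ᶜ) := by
        have h1 := InnerProductSpace.gramSchmidt_def'' ℝ v j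
        rw [← hu] at h1
        have h2 : u j - v j = - ∑ i ∈ Finset.Iio j,
            (inner ℝ (u i) (v j) / ((‖u i‖ : ℝ) : ℝ) ^ 2) • u i := by
          rw [eq_neg_iff_add_eq_zero, sub_add_eq_add_sub, sub_eq_zero]
          exact h1.symm
        rw [h2]
        refine Submodule.neg_mem _ (Submodule.sum_mem _ fun i hi => Submodule.smul_mem _ _ ?_)
        have hi' : i < j := by simpa using hi
        refine Submodule.subset_span ⟨i, hi'.ne, ?_⟩
        have : (i : ℕ) < k := hi'
        simp [hw, this]
      have h3 : u j = w j + (u j - v j) := by rw [hwj]; abel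
      rw [hupd, h3, f.map_update_add, f.map_update_of_mem_span w j hsub,
        Function.update_eq_self, add_zero]
  have h := key m le_rfl
  simpa using h

theorem norm_ιMulti_of_orthogonal {E : Type*} [NormedAddCommGroup E] [InnerProductSpace ℝ E]
    [FiniteDimensional ℝ E] {m : ℕ} (u : Fin m → E)
    (hu : Pairwise fun i j => inner ℝ (u i) (u j) = 0) :
    ‖exteriorPower.ιMulti ℝ m u‖ = ∏ i, ‖u i‖ := by
  have h : ‖exteriorPower.ιMulti ℝ m u‖ ^ 2 = (∏ i, ‖u i‖) ^ 2 := by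
    rw [← real_inner_self_eq_norm_sq, exteriorPower.inner_ιMulti_self]
    have : Matrix.gram ℝ u = Matrix.diagonal fun i => ‖u i‖ ^ 2 := by
      ext i j
      by_cases hij : i = j
      · subst hij; simp [Matrix.gram_apply]
      · simp [Matrix.gram_apply, hij, hu hij]
    rw [this, Matrix.det_diagonal, Finset.prod_pow]
  exact (pow_left_inj₀ (norm_nonneg _) (by positivity) two_ne_zero).1 h

theorem norm_ιMulti_eq_prod_gramSchmidt {E : Type*} [NormedAddCommGroup E]
    [InnerProductSpace ℝ E] [FiniteDimensional ℝ E] {m : ℕ} (v : Fin m → E) :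
    ‖exteriorPower.ιMulti ℝ m v‖ = ∏ i, ‖InnerProductSpace.gramSchmidt ℝ v i‖ := by
  rw [← (exteriorPower.ιMulti ℝ m).map_gramSchmidt v]
  exact norm_ιMulti_of_orthogonal _ fun i j hij => InnerProductSpace.gramSchmidt_orthogonal ℝ v hij

theorem norm_gramSchmidt_le {E : Type*} [NormedAddCommGroup E]
    [InnerProductSpace ℝ E] {m : ℕ} (v : Fin m → E) (j : Fin m) :
    ‖InnerProductSpace.gramSchmidt ℝ v j‖ ≤ ‖v j‖ := by
  rw [InnerProductSpace.gramSchmidt_def]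
  set u := InnerProductSpace.gramSchmidt ℝ v
  set s := ∑ i ∈ Finset.Iio j, (ℝ ∙ u i).starProjection (v j) with hs
  have horth : inner ℝ (v j - s) s = 0 := by
    rw [hs, inner_sum]
    refine Finset.sum_eq_zero fun i hi => ?_
    rw [← hs]
    have hi' : i < j := by simpa using hi
    have h1 : v j - s = u j := by
      simp only [u]; rw [InnerProductSpace.gramSchmidt_def]
    rw [h1, Submodule.starProjection_singleton, inner_smul_right,
      InnerProductSpace.gramSchmidt_orthogonal ℝ v hi'.ne', mul_zero]
  have h2 : ‖v j‖ ^ 2 = ‖v j - s‖ ^ 2 + ‖s‖ ^ 2 := by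
    have := norm_add_sq_real (v j - s) s
    rw [sub_add_cancel, horth] at this
    linarith
  exact le_of_sq_le_sq (by nlinarith [sq_nonneg ‖s‖]) (norm_nonneg _)

/-- Hadamard's inequality. -/
theorem norm_ιMulti_le {E : Type*} [NormedAddCommGroup E]
    [InnerProductSpace ℝ E] [FiniteDimensional ℝ E] {m : ℕ} (v : Fin m → E) :
    ‖exteriorPower.ιMulti ℝ m v‖ ≤ ∏ i, ‖v i‖ := by
  rw [norm_ιMulti_eq_prod_gramSchmidt]
  exact Finset.prod_le_prod (fun _ _ => norm_nonneg _) fun i _ => norm_gramSchmidt_le v i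

/-- Gram–Schmidt changes neither side, and for an orthogonal family the length of the simple vector
is the product of the norms, so this is the operator norm bound. -/
theorem norm_apply_le_norm_ιMulti {d m : ℕ} (φ : Covector d m) (v : Fin m → Space d) :
    ‖φ v‖ ≤ ‖φ‖ * ‖exteriorPower.ιMulti ℝ m v‖ := by
  have h : φ (InnerProductSpace.gramSchmidt ℝ v) = φ v := φ.toAlternatingMap.map_gramSchmidt v
  rw [← h, norm_ιMulti_eq_prod_gramSchmidt]
  exact φ.le_opNorm _

/-- One inequality is the Gram–Schmidt bound above. For the other, vectors are normalised; by
Hadamard, unit vectors span a simple vector of length at most `1`, hence admissible in the comass.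
-/
theorem comass_eq_enorm {d m : ℕ} (φ : Covector d m) : comass φ = ‖φ‖ₑ := by
  apply le_antisymm
  · refine iSup₂_le fun v hv => ?_
    rw [enorm_le_iff_norm_le]
    exact (norm_apply_le_norm_ιMulti φ v).trans (mul_le_of_le_one_right (norm_nonneg _) hv)
  · have hfin : comass φ ≤ ‖φ‖ₑ := by
      refine iSup₂_le fun v hv => ?_
      rw [enorm_le_iff_norm_le]
      exact (norm_apply_le_norm_ιMulti φ v).trans (mul_le_of_le_one_right (norm_nonneg _) hv)
    have hne : comass φ ≠ ∞ := (hfin.trans_lt enorm_lt_top).ne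
    rw [← ENNReal.ofReal_toReal hne, ← ofReal_norm]
    refine ENNReal.ofReal_le_ofReal ?_
    refine φ.opNorm_le_bound ENNReal.toReal_nonneg fun v => ?_
    by_cases h0 : ∃ i, v i = 0
    · obtain ⟨i, hi⟩ := h0
      rw [φ.map_coord_zero i hi, norm_zero]
      positivity
    · push Not at h0
      have hpos : 0 < ∏ i, ‖v i‖ := Finset.prod_pos fun i _ => norm_pos_iff.2 (h0 i)
      set u : Fin m → Space d := fun i => ‖v i‖⁻¹ • v i
      have hu : ‖exteriorPower.ιMulti ℝ m u‖ ≤ 1 := by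
        refine (norm_ιMulti_le u).trans (le_of_eq (Finset.prod_eq_one fun i _ => ?_))
        simp [u, norm_smul, h0 i]
      have h1 : φ v = (∏ i, ‖v i‖) • φ u := by
        rw [← φ.map_smul_univ]
        congr 1
        funext i
        simp [u, smul_smul, h0 i]
      have h2 : ‖φ u‖ ≤ (comass φ).toReal := by
        rw [← toReal_enorm]
        exact ENNReal.toReal_mono hne
          (le_iSup₂ (f := fun (v : Fin m → Space d) _ => ‖φ v‖ₑ) u hu)
      rw [h1, norm_smul, Real.norm_of_nonneg hpos.le, mul_comm]
      gcongr

theorem supComass_le_iff {d m : ℕ} {Y : Set (Space d)} {ω : Space d → Covector d m}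
    {C : ℝ≥0∞} : supComass Y ω ≤ C ↔ ∀ y ∈ Y, ‖ω y‖ₑ ≤ C := by
  simp [supComass, comass_eq_enorm]

theorem enorm_le_supComass {d m : ℕ} {Y : Set (Space d)} {ω : Space d → Covector d m}
    {y : Space d} (hy : y ∈ Y) : ‖ω y‖ₑ ≤ supComass Y ω :=
  supComass_le_iff.1 le_rfl y hy

/-! ### Antisymmetrisation and the exterior derivative of a wedge product -/

/-- The antisymmetrisation of a function of a family of vectors. -/
def antisymm {X E : Type*} [Fintype X] [DecidableEq X] (G : (X → E) → ℝ) (w : X → E) : ℝ :=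
  ∑ τ : Equiv.Perm X, ((Equiv.Perm.sign τ : ℤ) : ℝ) * G (w ∘ τ)

section antisymm

variable {X E : Type*} [Fintype X] [DecidableEq X]

theorem antisymm_comp_perm (G : (X → E) → ℝ) (σ : Equiv.Perm X) (w : X → E) :
    antisymm (fun u => G (u ∘ σ)) w = ((Equiv.Perm.sign σ : ℤ) : ℝ) * antisymm G w := by
  simp only [antisymm, Finset.mul_sum]
  refine Fintype.sum_equiv (Equiv.mulRight σ) _ _ fun τ => ?_
  have h : ((Equiv.Perm.sign σ : ℤ) : ℝ) * ((Equiv.Perm.sign σ : ℤ) : ℝ) = 1 := by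
    rcases Int.units_eq_one_or (Equiv.Perm.sign σ) with h | h <;> simp [h]
  simp only [Equiv.coe_mulRight, Equiv.Perm.sign_mul, Units.val_mul, Int.cast_mul,
    Equiv.Perm.coe_mul]
  have h' : w ∘ τ ∘ σ = (w ∘ τ) ∘ σ := rfl
  rw [h']
  linear_combination (-((Equiv.Perm.sign τ : ℤ) : ℝ) * G ((w ∘ τ) ∘ σ)) * h

theorem antisymm_sum {ι : Type*} (s : Finset ι) (G : ι → (X → E) → ℝ) (w : X → E) :
    antisymm (fun u => ∑ i ∈ s, G i u) w = ∑ i ∈ s, antisymm (G i) w := by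
  simp only [antisymm, Finset.mul_sum]
  rw [Finset.sum_comm]

theorem antisymm_const_mul (c : ℝ) (G : (X → E) → ℝ) (w : X → E) :
    antisymm (fun u => c * G u) w = c * antisymm G w := by
  simp only [antisymm, Finset.mul_sum]
  refine Finset.sum_congr rfl fun τ _ => by ring

/-- If `G` is a signed sum of `N` permuted copies of `H`, its antisymmetrisation is `N` times that
of `H`. -/
theorem antisymm_signed_sum {ι : Type*} [Fintype ι] (c : ι → Equiv.Perm X)
    {G H : (X → E) → ℝ}
    (hG : ∀ u, G u = ∑ p, ((Equiv.Perm.sign (c p) : ℤ) : ℝ) * H (u ∘ c p)) (w : X → E) :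
    antisymm G w = Fintype.card ι * antisymm H w := by
  rw [funext hG, antisymm_sum]
  simp only [antisymm_const_mul, antisymm_comp_perm H, ← mul_assoc]
  have h : ∀ p, ((Equiv.Perm.sign (c p) : ℤ) : ℝ) * ((Equiv.Perm.sign (c p) : ℤ) : ℝ) = 1 := by
    intro p
    rcases Int.units_eq_one_or (Equiv.Perm.sign (c p)) with h | h <;> simp [h]
  simp [h]

theorem antisymm_alternating [AddCommGroup E] [Module ℝ E] (φ : E [⋀^X]→ₗ[ℝ] ℝ) (w : X → E) :
    antisymm φ w = (Fintype.card X).factorial * φ w := by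
  have h : ∀ τ : Equiv.Perm X, ((Equiv.Perm.sign τ : ℤ) : ℝ) * φ (w ∘ τ) = φ w := by
    intro τ
    rw [φ.map_perm]
    rcases Int.units_eq_one_or (Equiv.Perm.sign τ) with h | h <;> simp [h]
  simp [antisymm, h, Fintype.card_perm]

theorem abs_antisymm_le [NormedAddCommGroup E] {G : (X → E) → ℝ} {C : ℝ}
    (hG : ∀ u, |G u| ≤ C * ∏ x, ‖u x‖) (w : X → E) :
    |antisymm G w| ≤ (Fintype.card X).factorial * (C * ∏ x, ‖w x‖) := by
  refine (Finset.abs_sum_le_sum_abs _ _).trans ?_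
  have h : ∀ τ : Equiv.Perm X, |((Equiv.Perm.sign τ : ℤ) : ℝ) * G (w ∘ τ)|
      ≤ C * ∏ x, ‖w x‖ := by
    intro τ
    have h1 : |((Equiv.Perm.sign τ : ℤ) : ℝ)| = 1 := by
      rcases Int.units_eq_one_or (Equiv.Perm.sign τ) with h | h <;> simp [h]
    rw [abs_mul, h1, one_mul]
    refine (hG _).trans_eq ?_
    congr 1
    exact Equiv.prod_comp τ fun x => ‖w x‖
  refine (Finset.sum_le_sum fun τ _ => h τ).trans_eq ?_
  simp [Fintype.card_perm]

end antisymm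

/-- The permutation of `Fin (n + 1)` that moves `p` to the front. -/
def frontPerm {n : ℕ} (p : Fin (n + 1)) : Equiv.Perm (Fin (n + 1)) := p.cycleRange⁻¹

theorem frontPerm_zero {n : ℕ} (p : Fin (n + 1)) : frontPerm p 0 = p := by
  simp [frontPerm, Equiv.Perm.inv_def]

theorem frontPerm_succ {n : ℕ} (p : Fin (n + 1)) (i : Fin n) :
    frontPerm p i.succ = p.succAbove i := by
  simp [frontPerm, Equiv.Perm.inv_def]

theorem sign_frontPerm {n : ℕ} (p : Fin (n + 1)) :
    Equiv.Perm.sign (frontPerm p) = (-1) ^ (p : ℕ) := by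
  simp [frontPerm, Fin.sign_cycleRange]

theorem alternatizeUncurryFin_eq_sum {d n : ℕ} (A : Space d →L[ℝ] Covector d n)
    (a : Fin (n + 1) → Space d) :
    ContinuousAlternatingMap.alternatizeUncurryFin A a =
      ∑ p, ((Equiv.Perm.sign (frontPerm p) : ℤ) : ℝ) *
        A (a (frontPerm p 0)) (fun i => a (frontPerm p i.succ)) := by
  rw [ContinuousAlternatingMap.alternatizeUncurryFin_apply]
  refine Finset.sum_congr rfl fun p _ => ?_
  rw [frontPerm_zero, sign_frontPerm]
  simp only [frontPerm_succ]
  simp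
  rfl

/-- The alternatization is a signed sum of `n + 1` permuted copies of `A`, and antisymmetrising an
alternating map multiplies it by `(n + 1)!`; cancelling `n + 1` leaves `n!`. -/
theorem antisymm_alternatizeUncurryFin {d n : ℕ} (A : Space d →L[ℝ] Covector d n)
    (w : Fin (n + 1) → Space d) :
    (n.factorial : ℝ) * ContinuousAlternatingMap.alternatizeUncurryFin A w =
      antisymm (fun u => A (u 0) (fun i => u i.succ)) w := by
  have h1 := antisymm_alternating
    (ContinuousAlternatingMap.alternatizeUncurryFin A).toAlternatingMap w
  have h2 := antisymm_signed_sum (X := Fin (n + 1)) (E := Space d) frontPerm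
    (G := fun u => ContinuousAlternatingMap.alternatizeUncurryFin A u)
    (H := fun u => A (u 0) (fun i => u i.succ)) (alternatizeUncurryFin_eq_sum A) w
  have h3 : ((n + 1 : ℕ) : ℝ) * ((n.factorial : ℝ) *
      ContinuousAlternatingMap.alternatizeUncurryFin A w) =
      ((n + 1 : ℕ) : ℝ) * antisymm (fun u => A (u 0) (fun i => u i.succ)) w := by
    rw [Fintype.card_fin] at h1 h2
    rw [← h2, ← mul_assoc, ← Nat.cast_mul, ← Nat.factorial_succ]
    exact h1.symm
  exact mul_left_cancel₀ (by positivity) h3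

/-- The wedge sums over shuffles, i.e. cosets of the permutations preserving the two blocks; summing
over all permutations counts each coset `m! n!` times. -/
theorem wedge_apply_eq_sum {d m n : ℕ} (φ : Covector d m) (ψ : Covector d n)
    (u : Fin (m + n) → Space d) :
    ((m.factorial * n.factorial : ℕ) : ℝ) * wedge φ ψ u =
      ∑ σ : Equiv.Perm (Fin m ⊕ Fin n), ((Equiv.Perm.sign σ : ℤ) : ℝ) *
        (φ (fun i => u (finSumFinEquiv (σ (Sum.inl i)))) *
          ψ (fun j => u (finSumFinEquiv (σ (Sum.inr j))))) := by
  have h := congrArg (fun f => LinearMap.mul' ℝ ℝ (f (u ∘ finSumFinEquiv)))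
    (MultilinearMap.domCoprod_alternization_eq φ.toAlternatingMap ψ.toAlternatingMap)
  simp only [Fintype.card_fin, AlternatingMap.smul_apply, map_nsmul] at h
  rw [nsmul_eq_mul] at h
  refine Eq.trans ?_ (h.symm.trans ?_)
  · rfl
  · rw [MultilinearMap.alternatization_apply, map_sum]
    refine Finset.sum_congr rfl fun σ _ => ?_
    rcases Int.units_eq_one_or (Equiv.Perm.sign σ) with h | h <;> simp [h]

theorem decomposeFin_zero_succ {n : ℕ} (σ : Equiv.Perm (Fin n)) (i : Fin n) :
    Equiv.Perm.decomposeFin.symm (0, σ) i.succ = (σ i).succ := by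
  simp

/-- Antisymmetrising in the last `m + n` variables first. -/
theorem antisymm_wedge {d m n : ℕ} (f : Space d → Covector d m) (g : Space d → Covector d n)
    (w : Fin (m + n + 1) → Space d) :
    ((m.factorial * n.factorial : ℕ) : ℝ) *
        antisymm (fun u => wedge (f (u 0)) (g (u 0)) (fun i => u i.succ)) w =
      (m + n).factorial * antisymm (fun u => f (u 0) (fun i => u (Fin.castAdd n i).succ) *
        g (u 0) (fun j => u (Fin.natAdd m j).succ)) w := by
  -- The permutations are those fixing the differentiation slot `0` and moving the other `m + n`
  -- variables.
  rw [← antisymm_const_mul, antisymm_signed_sum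
    (fun σ : Equiv.Perm (Fin m ⊕ Fin n) =>
      Equiv.Perm.decomposeFin.symm (0, finSumFinEquiv.permCongr σ))
    (H := fun u => f (u 0) (fun i => u (Fin.castAdd n i).succ) *
        g (u 0) (fun j => u (Fin.natAdd m j).succ))]
  · simp [Fintype.card_perm]
  · intro u
    rw [wedge_apply_eq_sum]
    refine Finset.sum_congr rfl fun σ _ => ?_
    simp only [Function.comp_apply, decomposeFin_zero_succ, Equiv.Perm.decomposeFin.symm_sign,
      Equiv.permCongr_apply]
    simp

/-- The bound on the exterior product of a differential with a covector, in a form which covers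
both factors. The index `e` tells where the variables go. -/
theorem abs_antisymm_mul_alternatizeUncurryFin_le {d m n : ℕ} {X : Type*} [Fintype X]
    [DecidableEq X] (A : Space d →L[ℝ] Covector d m) (η : Covector d n)
    (e : Fin (m + 1) ⊕ Fin n ≃ X) (w : X → Space d) :
    |antisymm (fun u => A (u (e (Sum.inl 0))) (fun i => u (e (Sum.inl i.succ))) *
        η (fun j => u (e (Sum.inr j)))) w| ≤
      (Fintype.card X).factorial *
        (‖ContinuousAlternatingMap.alternatizeUncurryFin A‖ * ‖η‖ * ∏ x, ‖w x‖) := by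
  have h1 := antisymm_signed_sum (X := X) (E := Space d)
    (fun p : Fin (m + 1) => e.permCongr (Equiv.Perm.sumCongr (frontPerm p) 1))
    (G := fun u => ContinuousAlternatingMap.alternatizeUncurryFin A (fun i => u (e (Sum.inl i))) *
      η (fun j => u (e (Sum.inr j))))
    (H := fun u => A (u (e (Sum.inl 0))) (fun i => u (e (Sum.inl i.succ))) *
        η (fun j => u (e (Sum.inr j))))
    (by
      intro u
      rw [alternatizeUncurryFin_eq_sum, Finset.sum_mul]
      refine Finset.sum_congr rfl fun p _ => ?_
      simp [Equiv.permCongr_apply, mul_assoc]) w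
  have h2 := abs_antisymm_le (X := X) (E := Space d)
    (G := fun u => ContinuousAlternatingMap.alternatizeUncurryFin A (fun i => u (e (Sum.inl i))) *
      η (fun j => u (e (Sum.inr j))))
    (C := ‖ContinuousAlternatingMap.alternatizeUncurryFin A‖ * ‖η‖) (by
      intro u
      rw [abs_mul, ← Equiv.prod_comp e, Fintype.prod_sum_type]
      have h3 := (ContinuousAlternatingMap.alternatizeUncurryFin A).le_opNorm
        (fun i => u (e (Sum.inl i)))
      have h4 := η.le_opNorm (fun j => u (e (Sum.inr j)))
      rw [Real.norm_eq_abs] at h3 h4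
      calc _ ≤ (‖ContinuousAlternatingMap.alternatizeUncurryFin A‖ * ∏ i, ‖u (e (Sum.inl i))‖) *
            (‖η‖ * ∏ j, ‖u (e (Sum.inr j))‖) := by gcongr
        _ = _ := by ring) w
  rw [h1, abs_mul] at h2
  -- The number of permuted copies is `m + 1 ≥ 1`, so it can be dropped.
  refine le_trans (le_mul_of_one_le_left (abs_nonneg _) ?_) h2
  rw [Nat.abs_cast, Fintype.card_fin]
  exact_mod_cast Nat.succ_pos m

theorem norm_wedge_le {d m n : ℕ} (φ : Covector d m) (ψ : Covector d n) :
    ‖wedge φ ψ‖ ≤ Fintype.card (Equiv.Perm.ModSumCongr (Fin m) (Fin n)) * ‖φ‖ * ‖ψ‖ :=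
  ContinuousAlternatingMap.opNorm_le_bound _ (by positivity) (norm_wedgeAlt_le φ ψ)

/-- Combining the two antisymmetrisation identities, `m! n!` times the alternatization of `A` is the
antisymmetrisation of the plain product `f · g`. Both factors depend on the direction so that the
derivative may fall on either one. -/
theorem norm_alternatizeUncurryFin_le_of_antisymm {d m n : ℕ} {f : Space d → Covector d m}
    {g : Space d → Covector d n} {A : Space d →L[ℝ] Covector d (m + n)}
    (hA : ∀ v, A v = wedge (f v) (g v)) {C : ℝ} (hC : 0 ≤ C)
    (h : ∀ w : Fin (m + n + 1) → Space d,
      |antisymm (fun u => f (u 0) (fun i => u (Fin.castAdd n i).succ) *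
        g (u 0) (fun j => u (Fin.natAdd m j).succ)) w| ≤ C * ∏ i, ‖w i‖) :
    ‖ContinuousAlternatingMap.alternatizeUncurryFin A‖ ≤ C := by
  refine ContinuousAlternatingMap.opNorm_le_bound _ hC fun w => ?_
  have h1 := antisymm_alternatizeUncurryFin A w
  have h2 := antisymm_wedge f g w
  simp only [hA] at h1
  rw [← h1] at h2
  have h3 : ((m.factorial * n.factorial : ℕ) : ℝ) *
      ContinuousAlternatingMap.alternatizeUncurryFin A w =
      antisymm (fun u => f (u 0) (fun i => u (Fin.castAdd n i).succ) *
        g (u 0) (fun j => u (Fin.natAdd m j).succ)) w := by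
    have : ((m + n).factorial : ℝ) ≠ 0 := by positivity
    apply mul_left_cancel₀ this
    rw [← h2]; ring
  have h4 : (1 : ℝ) ≤ ((m.factorial * n.factorial : ℕ) : ℝ) := by
    exact_mod_cast Nat.mul_pos m.factorial_pos n.factorial_pos
  rw [Real.norm_eq_abs]
  refine le_trans (le_mul_of_one_le_left (abs_nonneg _) h4) ?_
  rw [← abs_of_nonneg (zero_le_one.trans h4), ← abs_mul, h3]
  exact h w

theorem norm_alternatizeUncurryFin_wedge_left_le {d m n : ℕ} (A : Space d →L[ℝ] Covector d m)
    (η : Covector d n) {B : Space d →L[ℝ] Covector d (m + n)} (hB : ∀ v, B v = wedge (A v) η) :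
    ‖ContinuousAlternatingMap.alternatizeUncurryFin B‖ ≤
      (m + n + 1).factorial * (‖ContinuousAlternatingMap.alternatizeUncurryFin A‖ * ‖η‖) := by
  refine norm_alternatizeUncurryFin_le_of_antisymm (f := A) (g := fun _ => η) hB
    (by positivity) fun w => ?_
  let e : Fin (m + 1) ⊕ Fin n ≃ Fin (m + n + 1) :=
    finSumFinEquiv.trans (finCongr (by omega))
  have h := abs_antisymm_mul_alternatizeUncurryFin_le A η e w
  have h0 : e (Sum.inl 0) = 0 := by ext; simp [e]
  have h1 : ∀ i : Fin m, e (Sum.inl i.succ) = (Fin.castAdd n i).succ := fun i => by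
    ext; simp [e]
  have h2 : ∀ j : Fin n, e (Sum.inr j) = (Fin.natAdd m j).succ := fun i => by
    ext; simp [e]; omega
  simp only [h0, h1, h2, Fintype.card_fin] at h
  rw [mul_assoc]
  exact h

/-- Here the slots of `ω` separate the differentiation variable from the other arguments of `A`. The
antisymmetrised bound holds for any placement `e` of the variables, so no sign has to be tracked. -/
theorem norm_alternatizeUncurryFin_wedge_right_le {d m n : ℕ} (ω : Covector d m)
    (A : Space d →L[ℝ] Covector d n) {B : Space d →L[ℝ] Covector d (m + n)}
    (hB : ∀ v, B v = wedge ω (A v)) :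
    ‖ContinuousAlternatingMap.alternatizeUncurryFin B‖ ≤
      (m + n + 1).factorial * (‖ω‖ * ‖ContinuousAlternatingMap.alternatizeUncurryFin A‖) := by
  refine norm_alternatizeUncurryFin_le_of_antisymm (f := fun _ => ω) (g := A) hB
    (by positivity) fun w => ?_
  -- `A` receives slot `0` and the last `n` slots; `ω` receives the slots `1, …, m`.
  let e₀ : Fin (n + 1) ⊕ Fin m → Fin (m + n + 1) :=
    Sum.elim (Fin.cons 0 fun j => (Fin.natAdd m j).succ) fun i => (Fin.castAdd n i).succ
  have he₀ : Function.Bijective e₀ := by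
    rw [Fintype.bijective_iff_injective_and_card]
    refine ⟨?_, by simp; omega⟩
    rintro (i | i) (j | j) h
    · refine congrArg Sum.inl ?_
      revert h
      refine Fin.cases ?_ (fun i => ?_) i <;> refine Fin.cases ?_ (fun j => ?_) j <;>
        simp [e₀, Fin.ext_iff]
    · exfalso
      revert h
      refine Fin.cases ?_ (fun i => ?_) i
      · simp [e₀, Fin.ext_iff]
      · have := j.2
        simp [e₀, Fin.ext_iff]
        omega
    · exfalso
      revert h
      refine Fin.cases ?_ (fun j => ?_) j
      · simp [e₀, Fin.ext_iff]
      · have := i.2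
        simp [e₀, Fin.ext_iff]
        omega
    · refine congrArg Sum.inr ?_
      simpa [e₀, Fin.ext_iff] using h
  have h := abs_antisymm_mul_alternatizeUncurryFin_le A ω (Equiv.ofBijective e₀ he₀) w
  simp only [Equiv.ofBijective_apply, e₀, Sum.elim_inl, Sum.elim_inr, Fin.cons_zero,
    Fin.cons_succ, Fintype.card_fin] at h
  simp only [mul_comm (A _ _)] at h
  rw [mul_comm ‖ω‖, mul_assoc]
  exact h

/-! ### Geometry of Lipschitz retracts -/

/-- For `z` on a segment with endpoints in `K`, `ρ z` is no farther from either endpoint than `z`.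
The triangle inequality forces equality, so `ρ z` lies on the segment at the same distances, and `ρ
z = z`. -/
theorem IsOneLipschitzRetract.convex {d : ℕ} {K : Set (Space d)} (hK : IsOneLipschitzRetract K) :
    Convex ℝ K := by
  obtain ⟨ρ, hρ, hmem, hid⟩ := hK
  rw [convex_iff_segment_subset]
  intro x hx y hy z hz
  have h1 : dist x (ρ z) ≤ dist x z := by
    simpa [hid x hx] using hρ.dist_le_mul x z
  have h2 : dist (ρ z) y ≤ dist z y := by
    simpa [hid y hy] using hρ.dist_le_mul z y
  have h3 := dist_add_dist_of_mem_segment hz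
  have h4 := dist_triangle x (ρ z) y
  have h5 : dist x (ρ z) = dist x z := by linarith
  have h6 : dist (ρ z) y = dist z y := by linarith
  have h7 : ρ z ∈ segment ℝ x y := by
    rw [mem_segment_iff_wbtw, ← dist_add_dist_eq_iff]; linarith
  have : ρ z = z := by
    rw [segment_eq_image_lineMap] at hz h7
    obtain ⟨s, hs, rfl⟩ := hz
    obtain ⟨t, ht, h8⟩ := h7
    rw [← h8] at h5 ⊢
    simp only [dist_left_lineMap, Real.norm_of_nonneg hs.1, Real.norm_of_nonneg ht.1] at h5
    by_cases hxy : x = y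
    · subst hxy; simp
    · rw [mul_right_cancel₀ (dist_ne_zero.2 hxy) h5]
  rw [← this]
  exact hmem z

/-- A set with empty interior lies in its frontier, and the frontier of a convex set is Lebesgue
null. -/
theorem OpenSubsetsPos.interior_nonempty {d : ℕ} {K : Set (Space d)} (hK : OpenSubsetsPos K)
    (hconv : Convex ℝ K) (hne : K.Nonempty) : (interior K).Nonempty := by
  by_contra h
  rw [Set.not_nonempty_iff_eq_empty] at h
  have h1 := hK Set.univ isOpen_univ (by simpa using hne)
  have h2 : K ⊆ frontier K := by
    rw [frontier, h, Set.sdiff_empty]; exact subset_closure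
  rw [Set.univ_inter] at h1
  exact h1.ne' (MeasureTheory.measure_mono_null h2 (hconv.addHaar_frontier _))

theorem IsOneLipschitzRetract.nonempty {d : ℕ} {K : Set (Space d)}
    (hK : IsOneLipschitzRetract K) : K.Nonempty := by
  obtain ⟨ρ, -, hmem, -⟩ := hK
  exact ⟨ρ 0, hmem 0⟩

open MeasureTheory in
/-- Mollifying a `1`-Lipschitz retraction onto a convex set. -/
theorem exists_smooth_retraction {d : ℕ} {K : Set (Space d)} (hK : IsOneLipschitzRetract K)
    (hclosed : IsClosed K) {δ : ℝ} (hδ : 0 < δ) :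
    ∃ f : Space d → Space d, ContDiff ℝ ((⊤ : ℕ∞) : WithTop ℕ∞) f ∧ LipschitzWith 1 f ∧
      (∀ x, f x ∈ K) ∧ ∀ x, Metric.ball x δ ⊆ K → f x = x := by
  have hconv := hK.convex
  obtain ⟨ρ, hρ, hmem, hid⟩ := hK
  let φ : ContDiffBump (0 : Space d) := ⟨δ / 2, δ, by positivity, by linarith⟩
  set Φ : Space d → ℝ := φ.normed volume with hΦ
  have hΦ0 : ∀ y, 0 ≤ Φ y := φ.nonneg_normed
  have hΦ1 : ∫ y, Φ y = 1 := φ.integral_normed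
  have hΦs : HasCompactSupport Φ := φ.hasCompactSupport_normed
  have hΦc : Continuous Φ := φ.continuous_normed
  have hint : ∀ {g : Space d → Space d}, Continuous g → Integrable (fun y => Φ y • g y) := by
    intro g hg
    exact (hΦc.smul hg).integrable_of_hasCompactSupport hΦs.smul_right
  let f : Space d → Space d := fun x => ∫ y, Φ y • ρ (x - y)
  have hf : f = convolution Φ ρ (ContinuousLinearMap.lsmul ℝ ℝ) volume := rfl
  refine ⟨f, ?_, ?_, ?_, ?_⟩
  · rw [hf]
    exact hΦs.contDiff_convolution_left _ φ.contDiff_normed hρ.continuous.locallyIntegrable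
  · refine LipschitzWith.of_dist_le_mul fun x x' => ?_
    rw [dist_eq_norm, NNReal.coe_one, one_mul]
    have h1 := hint (g := fun y => ρ (x - y)) (by have := hρ.continuous; fun_prop)
    have h2 := hint (g := fun y => ρ (x' - y)) (by have := hρ.continuous; fun_prop)
    rw [← integral_sub h1 h2]
    calc ‖∫ y, (Φ y • ρ (x - y) - Φ y • ρ (x' - y))‖ ≤ ∫ y, Φ y * dist x x' := by
          refine norm_integral_le_of_norm_le (φ.integrable_normed.mul_const _)
            (Filter.Eventually.of_forall fun y => ?_)
          rw [← smul_sub, norm_smul, Real.norm_of_nonneg (hΦ0 y), ← dist_eq_norm]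
          refine mul_le_mul_of_nonneg_left ?_ (hΦ0 y)
          simpa using hρ.dist_le_mul (x - y) (x' - y)
      _ = dist x x' := by rw [integral_mul_const, hΦ1, one_mul]
  · intro x
    -- `f x` is the barycentre of points of `K` for the probability measure `Φ dy`, hence in `K` by
    -- convexity and closedness.
    let μ : Measure (Space d) := volume.withDensity fun y => ENNReal.ofReal (Φ y)
    have hμ : IsProbabilityMeasure μ := by
      refine ⟨?_⟩
      rw [withDensity_apply _ MeasurableSet.univ, Measure.restrict_univ,
        ← ofReal_integral_eq_lintegral_ofReal φ.integrable_normed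
          (Filter.Eventually.of_forall hΦ0)]
      change ENNReal.ofReal (∫ y, Φ y) = 1
      rw [hΦ1, ENNReal.ofReal_one]
    have hmeas : Measurable fun y => (Φ y).toNNReal := hΦc.measurable.real_toNNReal
    have h1 : f x = ∫ y, ρ (x - y) ∂μ := by
      have := integral_withDensity_eq_integral_smul (μ := volume) hmeas fun y => ρ (x - y)
      refine Eq.trans ?_ this.symm
      refine integral_congr_ae (Filter.Eventually.of_forall fun y => ?_)
      simp only [NNReal.smul_def, Real.coe_toNNReal _ (hΦ0 y)]
    rw [h1]
    refine hconv.integral_mem hclosed (Filter.Eventually.of_forall fun y => hmem _) ?_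
    refine (integrable_withDensity_iff_integrable_smul hmeas).2 ?_
    refine (hint (g := fun y => ρ (x - y)) (by have := hρ.continuous; fun_prop)).congr
      (Filter.Eventually.of_forall fun y => ?_)
    simp only [NNReal.smul_def, Real.coe_toNNReal _ (hΦ0 y)]
  · intro x hx
    have h1 : ∀ y, Φ y • ρ (x - y) = Φ y • x - Φ y • y := by
      intro y
      by_cases hy : Φ y = 0
      · simp [hy]
      · have h2 : y ∈ Metric.ball (0 : Space d) δ := by
          rw [← φ.support_normed_eq (μ := volume)]; exact hy
        rw [hid (x - y) (hx (by simpa using h2)), smul_sub]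
    -- The bump is even, so its first moment vanishes and averaging the identity over a ball returns
    -- the centre.
    have h2 : ∫ y, Φ y • y = 0 := by
      have h3 := integral_neg_eq_self (fun y => Φ y • y) (volume : Measure (Space d))
      simp only [hΦ, φ.normed_neg, smul_neg, integral_neg] at h3
      have h4 := eq_neg_iff_add_eq_zero.1 h3.symm
      rw [← two_smul ℝ] at h4
      exact (smul_eq_zero.1 h4).resolve_left two_ne_zero
    change ∫ y, Φ y • ρ (x - y) = x
    simp only [h1]
    rw [integral_sub (hint continuous_const) (hint (g := fun y => y) continuous_id), h2, sub_zero,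
      integral_smul_const, hΦ1, one_smul]

/-- For a convex retract `K` with interior point `p`, a smooth `1`-Lipschitz map into `K` which is
the homothety of centre `p` and ratio `c` near `K`. -/
theorem exists_smooth_contraction {d : ℕ} {K : Set (Space d)} (hK : IsOneLipschitzRetract K)
    (hcomp : IsCompact K) {p : Space d} (hp : p ∈ interior K) {c : ℝ} (hc0 : 0 < c) (hc : c < 1) :
    ∃ f : Space d → Space d, ContDiff ℝ ((⊤ : ℕ∞) : WithTop ℕ∞) f ∧ LipschitzWith 1 f ∧
      (∀ x, f x ∈ K) ∧ ∀ᶠ x in 𝓝ˢ K, f x = p + c • (x - p) := by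
  have hconv := hK.convex
  let h : Space d → Space d := fun x => p + c • (x - p)
  have hsmooth : ContDiff ℝ ((⊤ : ℕ∞) : WithTop ℕ∞) h := by fun_prop
  have hcont : Continuous h := hsmooth.continuous
  have hint : h '' K ⊆ interior K := by
    rintro _ ⟨x, hx, rfl⟩
    have := hconv.combo_interior_self_mem_interior hp hx (sub_pos.2 hc) hc0.le
      (sub_add_cancel 1 c)
    convert this using 1
    simp only [h]
    module
  obtain ⟨δ, hδ, hsub⟩ := lebesgue_number_lemma_of_metric (c := fun _ : Unit => interior K)
    (hcomp.image hcont) (fun _ => isOpen_interior) (hint.trans (Set.subset_iUnion (fun _ : Unit => interior K) ()))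
  -- One half of `δ` is the mollification radius, the other absorbs the move from a point of `K` to
  -- a nearby one.
  obtain ⟨g, hg, hgl, hgK, hgid⟩ := exists_smooth_retraction hK hcomp.isClosed (half_pos hδ)
  refine ⟨g ∘ h, hg.comp hsmooth, ?_, fun x => hgK _, ?_⟩
  · have : LipschitzWith 1 h := by
      refine LipschitzWith.of_dist_le_mul fun x y => ?_
      simp only [h, dist_add_left, NNReal.coe_one, one_mul]
      rw [dist_smul₀, dist_sub_right, Real.norm_of_nonneg hc0.le]
      exact mul_le_of_le_one_left dist_nonneg hc.le
    exact (hgl.comp this).weaken (by simp)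
  · refine eventually_nhdsSet_iff_forall.2 fun z hz => ?_
    filter_upwards [hcont.continuousAt.eventually (Metric.ball_mem_nhds (h z) (half_pos hδ))]
      with x hx
    refine hgid _ fun y hy => interior_subset ?_
    obtain ⟨-, hi⟩ := hsub (h z) (Set.mem_image_of_mem h hz)
    refine hi (Metric.mem_ball.2 ?_)
    have := dist_triangle y (h x) (h z)
    rw [Metric.mem_ball] at hy
    linarith

open MeasureTheory

/-! ### Currents given by a density and a simple vector -/

theorem contDiff_extDeriv {d m : ℕ} {ω : Space d → Covector d m}
    (hω : ContDiff ℝ ((⊤ : ℕ∞) : WithTop ℕ∞) ω) :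
    ContDiff ℝ ((⊤ : ℕ∞) : WithTop ℕ∞) (extDeriv ω) :=
  (ContinuousAlternatingMap.alternatizeUncurryFinCLM (n := m) ℝ (Space d) ℝ).contDiff.comp
    (hω.fderiv_right (by simp))

/-- The `m`-current `φ ↦ ∫ ⟨v₁ ∧ ⋯ ∧ v_m, φ(x)⟩ g(x) dx`. -/
def simpleCurrent {d m : ℕ} (g : Space d → ℝ) (v : Fin m → Space d) : Current d m :=
  TestFunction.integralAgainstBilinCLM
    ((ContinuousLinearMap.mul ℝ ℝ).comp (ContinuousAlternatingMap.apply ℝ (Space d) ℝ v)) volume g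

theorem simpleCurrent_apply {d m : ℕ} {g : Space d → ℝ} (hg : Continuous g)
    (v : Fin m → Space d) (φ : TestForm d m) :
    simpleCurrent g v φ = ∫ x, φ x v * g x := by
  rw [simpleCurrent, TestFunction.integralAgainstBilinCLM_eq_integral
    (hg.locallyIntegrable.locallyIntegrableOn _)]
  rfl

theorem continuous_apply_vec {d m : ℕ} {ω : Space d → Covector d m} (hω : Continuous ω)
    (v : Fin m → Space d) : Continuous fun x => ω x v :=
  (ContinuousAlternatingMap.apply ℝ (Space d) ℝ v).continuous.comp hω

theorem norm_integral_mul_le {d m : ℕ} {g : Space d → ℝ} (hg : Integrable g)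
    (v : Fin m → Space d) {ω : Space d → Covector d m} (hω : ∀ x, ‖ω x‖ ≤ 1) :
    ‖∫ x, ω x v * g x‖ ≤ (∏ i, ‖v i‖) * ∫ x, |g x| := by
  rw [← integral_const_mul]
  refine norm_integral_le_of_norm_le (hg.abs.const_mul _) (Filter.Eventually.of_forall fun x => ?_)
  rw [norm_mul, Real.norm_eq_abs (g x)]
  refine mul_le_mul_of_nonneg_right ?_ (abs_nonneg _)
  refine ((ω x).le_opNorm v).trans (mul_le_of_le_one_left (by positivity) (hω x))

theorem norm_le_one_of_supComass_le {d m : ℕ} {ω : Space d → Covector d m}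
    (h : supComass Set.univ ω ≤ 1) (x : Space d) : ‖ω x‖ ≤ 1 := by
  have := supComass_le_iff.1 h x trivial
  rwa [← enorm_one (G := ℝ), enorm_le_iff_norm_le, norm_one] at this

theorem mass_simpleCurrent_le {d m : ℕ} {g : Space d → ℝ} (hg : Continuous g)
    (hgc : HasCompactSupport g) (v : Fin m → Space d) :
    (simpleCurrent g v).mass ≤ ENNReal.ofReal ((∏ i, ‖v i‖) * ∫ x, |g x|) := by
  refine iSup₂_le fun φ hφ => ?_
  rw [simpleCurrent_apply hg, ← ofReal_norm]
  exact ENNReal.ofReal_le_ofReal (norm_integral_mul_le (hg.integrable_of_hasCompactSupport hgc) v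
    (norm_le_one_of_supComass_le hφ))

theorem Current.flatNorm_le_mass {d m : ℕ} (T : Current d m) : T.flatNorm ≤ T.mass :=
  iSup₂_le fun φ hφ => le_iSup₂ (f := fun (φ : TestForm d m) _ => ‖T φ‖ₑ) φ
    ((le_max_left _ _).trans hφ)

/-- If `φ` is admissible for the flat norm, then `dφ` is admissible for the mass. -/
theorem Current.flatNorm_boundary_le_mass {d m : ℕ} (T : Current d (m + 1)) :
    T.boundary.flatNorm ≤ T.mass := by
  refine iSup₂_le fun φ hφ => ?_
  refine le_iSup₂ (f := fun (φ : TestForm d (m + 1)) _ => ‖T φ‖ₑ) (testD d m φ) ?_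
  have h : (⇑(testD d m φ) : Space d → Covector d (m + 1)) = extDeriv φ := funext (testD_apply φ)
  rw [h]
  exact (le_max_right _ _).trans hφ

theorem Current.boundary_boundary {d m : ℕ} (T : Current d (m + 2)) :
    T.boundary.boundary = 0 := by
  ext φ
  have h : testD d (m + 1) (testD d m φ) = 0 := by
    ext1 x
    rw [testD_apply]
    have h : (⇑(testD d m φ) : Space d → Covector d (m + 1)) = extDeriv φ :=
      funext (testD_apply φ)
    rw [h, extDeriv_extDeriv φ.contDiff
      (by rw [minSmoothness_of_isRCLikeNormedField]; exact WithTop.coe_le_coe.2 (le_top (a := (2 : ℕ∞))))]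
    rfl
  change T (testD d (m + 1) (testD d m φ)) = 0
  rw [h, map_zero]

theorem Current.mass_sum_lt_top {d m : ℕ} {ι : Type*} (s : Finset ι) (T : ι → Current d m)
    (h : ∀ i ∈ s, (T i).mass < ∞) : (∑ i ∈ s, T i).mass < ∞ := by
  classical
  induction s using Finset.induction_on with
  | empty => simp [Current.mass_zero]
  | insert i s hi ih =>
    rw [Finset.sum_insert hi]
    refine (Current.mass_add_le _ _).trans_lt (ENNReal.add_lt_top.2 ⟨h i (by simp), ih ?_⟩)
    exact fun j hj => h j (by simp [hj])

/-- Integration by parts, term by term in `dφ(v)`. It serves only to show that the boundary has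
finite mass. -/
theorem boundary_simpleCurrent {d m : ℕ} {g : Space d → ℝ} (hg : ContDiff ℝ 1 g)
    (hgc : HasCompactSupport g) (v : Fin (m + 1) → Space d) :
    (simpleCurrent g v).boundary =
      ∑ i : Fin (m + 1), (-(-1 : ℝ) ^ (i : ℕ)) •
        simpleCurrent (fun x => fderiv ℝ g x (v i)) (i.removeNth v) := by
  have hg' : ∀ w, Continuous fun x => fderiv ℝ g x w := fun w =>
    (hg.continuous_fderiv one_ne_zero).clm_apply continuous_const
  have hgc' : ∀ w, HasCompactSupport fun x => fderiv ℝ g x w := fun w =>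
    hgc.fderiv_apply (𝕜 := ℝ) w
  ext φ
  change simpleCurrent g v (testD d m φ) = _
  rw [simpleCurrent_apply hg.continuous, sum_apply]
  simp only [smul_apply, simpleCurrent_apply (hg' _), testD_apply]
  have hφ : Differentiable ℝ φ := φ.contDiff.differentiable (by simp)
  have hφv : ∀ w : Fin m → Space d, ContDiff ℝ 1 fun x => φ x w := fun w =>
    (ContinuousAlternatingMap.apply ℝ (Space d) ℝ w).contDiff.comp (φ.contDiff.of_le (by simp))
  have hφ' : ∀ (w : Fin m → Space d) (u : Space d),
      Continuous fun x => fderiv ℝ (fun y => φ y w) x u := fun w u =>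
    ((hφv w).continuous_fderiv one_ne_zero).clm_apply continuous_const
  have hz : ∀ (k : ℕ) (r : ℝ), (-1 : ℤ) ^ k • r = (-1 : ℝ) ^ k * r := fun k r => by
    rw [zsmul_eq_mul]; push_cast; rfl
  simp only [extDeriv_apply (hφ _), Finset.sum_mul, hz, smul_eq_mul]
  rw [integral_finsetSum]
  · refine Finset.sum_congr rfl fun i _ => ?_
    have h := integral_mul_fderiv_eq_neg_fderiv_mul_of_integrable (μ := (volume : Measure (Space d)))
      (f := g) (g := fun x => φ x (i.removeNth v)) (v := v i)
      (((hg' _).mul (hφv _).continuous).integrable_of_hasCompactSupport (hgc' _).mul_right)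
      ((hg.continuous.mul (hφ' _ _)).integrable_of_hasCompactSupport hgc.mul_right)
      ((hg.continuous.mul (hφv _).continuous).integrable_of_hasCompactSupport hgc.mul_right)
      (fun x _ => hg.differentiable one_ne_zero x)
      (fun x _ => (hφv _).differentiable one_ne_zero x)
    simp only [mul_assoc]
    rw [integral_const_mul, neg_mul_comm]
    simp only [mul_comm (fderiv ℝ (fun y => φ y (i.removeNth v)) _ _) (g _),
      mul_comm (φ _ (i.removeNth v)) _, h]
  · intro i _
    refine Continuous.integrable_of_hasCompactSupport ?_ hgc.mul_left
    exact (continuous_const.mul (hφ' _ _)).mul hg.continuous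

theorem mass_boundary_simpleCurrent_lt_top {d m : ℕ} {g : Space d → ℝ} (hg : ContDiff ℝ 1 g)
    (hgc : HasCompactSupport g) (v : Fin (m + 1) → Space d) :
    (simpleCurrent g v).boundary.mass < ∞ := by
  rw [boundary_simpleCurrent hg hgc]
  refine Current.mass_sum_lt_top _ _ fun i _ => ?_
  refine (Current.mass_smul_le _ _).trans_lt (ENNReal.mul_lt_top (by simp) ?_)
  refine (mass_simpleCurrent_le ?_ (hgc.fderiv_apply (𝕜 := ℝ) _) _).trans_lt ENNReal.ofReal_lt_top
  exact (hg.continuous_fderiv one_ne_zero).clm_apply continuous_const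

theorem Current.spt_subset_of_forall {d m : ℕ} {T : Current d m} {S : Set (Space d)}
    (hS : IsClosed S) (h : ∀ φ : TestForm d m, Disjoint (tsupport φ) S → T φ = 0) :
    T.spt ⊆ S := by
  intro x hx
  by_contra hxS
  exact (Distribution.notMem_dsupport_iff x).2
    ⟨Sᶜ, fun φ hφ => h φ (Set.subset_compl_iff_disjoint_right.1 hφ), hS.isOpen_compl, hxS⟩ hx

theorem integral_mul_eq_zero_of_disjoint {d m : ℕ} {g : Space d → ℝ} (v : Fin m → Space d)
    {ω : Space d → Covector d m} (h : ∀ x ∈ tsupport g, ω x = 0) : ∫ x, ω x v * g x = 0 := by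
  refine integral_eq_zero_of_ae (Filter.Eventually.of_forall fun x => ?_)
  by_cases hx : x ∈ tsupport g
  · simp [h x hx]
  · simp [image_eq_zero_of_notMem_tsupport hx]

theorem spt_simpleCurrent_subset {d m : ℕ} {g : Space d → ℝ} (hg : Continuous g)
    (v : Fin m → Space d) : (simpleCurrent g v).spt ⊆ tsupport g := by
  refine Current.spt_subset_of_forall (isClosed_tsupport g) fun φ hφ => ?_
  rw [simpleCurrent_apply hg]
  exact integral_mul_eq_zero_of_disjoint v fun x hx =>
    image_eq_zero_of_notMem_tsupport (hφ.notMem_of_mem_right hx)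

theorem boundary_simpleCurrent_apply {d m : ℕ} {g : Space d → ℝ} (hg : Continuous g)
    (v : Fin (m + 1) → Space d) (φ : TestForm d m) :
    (simpleCurrent g v).boundary φ = ∫ x, extDeriv φ x v * g x := by
  change simpleCurrent g v (testD d m φ) = _
  rw [simpleCurrent_apply hg]
  simp only [testD_apply]

theorem extDeriv_eq_zero_of_notMem_tsupport {d m : ℕ} {ω : Space d → Covector d m} {x : Space d}
    (hx : x ∉ tsupport ω) : extDeriv ω x = 0 := by
  rw [extDeriv, fderiv_of_notMem_tsupport ℝ hx]
  exact map_zero (ContinuousAlternatingMap.alternatizeUncurryFinCLM (n := m) ℝ (Space d) ℝ)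

theorem spt_boundary_simpleCurrent_subset {d m : ℕ} {g : Space d → ℝ} (hg : Continuous g)
    (v : Fin (m + 1) → Space d) : (simpleCurrent g v).boundary.spt ⊆ tsupport g := by
  refine Current.spt_subset_of_forall (isClosed_tsupport g) fun φ hφ => ?_
  rw [boundary_simpleCurrent_apply hg]
  exact integral_mul_eq_zero_of_disjoint v fun x hx =>
    extDeriv_eq_zero_of_notMem_tsupport (hφ.notMem_of_mem_right hx)

theorem simpleCurrent_mem {d m : ℕ} {K : Compacts (Space d)} {g : Space d → ℝ}
    (hg : ContDiff ℝ 1 g) (hgc : HasCompactSupport g) (hgK : tsupport g ⊆ K)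
    (v : Fin m → Space d) : simpleCurrent g v ∈ normalCurrents m K := by
  refine ⟨ENNReal.add_lt_top.2 ⟨(mass_simpleCurrent_le hg.continuous hgc v).trans_lt
    ENNReal.ofReal_lt_top, ?_⟩, (spt_simpleCurrent_subset hg.continuous v).trans hgK⟩
  cases m with
  | zero => simp [Current.boundaryMass]
  | succ m => exact mass_boundary_simpleCurrent_lt_top hg hgc v

theorem boundary_simpleCurrent_mem {d m : ℕ} {K : Compacts (Space d)} {g : Space d → ℝ}
    (hg : ContDiff ℝ 1 g) (hgc : HasCompactSupport g) (hgK : tsupport g ⊆ K)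
    (v : Fin (m + 1) → Space d) : (simpleCurrent g v).boundary ∈ normalCurrents m K := by
  refine ⟨ENNReal.add_lt_top.2 ⟨mass_boundary_simpleCurrent_lt_top hg hgc v, ?_⟩,
    (spt_boundary_simpleCurrent_subset hg.continuous v).trans hgK⟩
  cases m with
  | zero => simp [Current.boundaryMass]
  | succ m =>
    change (simpleCurrent g v).boundary.boundary.mass < ∞
    simp [Current.boundary_boundary, Current.mass_zero]

/-! ### The lower bound -/

theorem SmoothForm.cut_eventuallyEq {d m : ℕ} (ω : SmoothForm d m) (K : Compacts (Space d)) :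
    ∀ᶠ x in 𝓝ˢ (K : Set (Space d)), ω.cut K x = ω.toFun x := by
  filter_upwards [cutoff_eq_one K] with x hx
  change cutoff K x • ω.toFun x = _
  rw [hx, one_smul]

theorem simpleCurrent_cut {d m : ℕ} (ω : SmoothForm d m) {K : Compacts (Space d)}
    {g : Space d → ℝ} (hg : Continuous g) (hgK : tsupport g ⊆ K) (v : Fin m → Space d) :
    simpleCurrent g v (ω.cut K) = ∫ x, ω.toFun x v * g x := by
  rw [simpleCurrent_apply hg]
  refine integral_congr_ae (Filter.Eventually.of_forall fun x => ?_)
  by_cases hx : x ∈ tsupport g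
  · simp only [(ω.cut_eventuallyEq K).self_of_nhdsSet x (hgK hx)]
  · simp [image_eq_zero_of_notMem_tsupport hx]

theorem boundary_simpleCurrent_cut {d m : ℕ} (ω : SmoothForm d m) {K : Compacts (Space d)}
    {g : Space d → ℝ} (hg : Continuous g) (hgK : tsupport g ⊆ K) (v : Fin (m + 1) → Space d) :
    (simpleCurrent g v).boundary (ω.cut K) = ∫ x, extDeriv ω.toFun x v * g x := by
  rw [boundary_simpleCurrent_apply hg]
  refine integral_congr_ae (Filter.Eventually.of_forall fun x => ?_)
  by_cases hx : x ∈ tsupport g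
  · have h : (ω.cut K : Space d → Covector d m) =ᶠ[𝓝 x] ω.toFun :=
      eventually_nhdsSet_iff_forall.1 (ω.cut_eventuallyEq K) x (hgK hx)
    simp only [h.extDeriv_eq]
  · simp [image_eq_zero_of_notMem_tsupport hx]

theorem abs_le_of_forall_bump {d : ℕ} {a : Space d → ℝ} (ha : Continuous a) {U : Set (Space d)}
    (hU : IsOpen U) {y : Space d} (hy : y ∈ U) {C : ℝ}
    (h : ∀ g : ContDiffBump y, Metric.closedBall y g.rOut ⊆ U →
      |∫ x, a x * g.normed volume x| ≤ C) : |a y| ≤ C := by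
  refine le_of_forall_pos_le_add fun ε hε => ?_
  obtain ⟨δ, hδ, hδU⟩ := Metric.isOpen_iff.1 hU y hy
  obtain ⟨δ', hδ', hδa⟩ := Metric.continuousAt_iff.1 ha.continuousAt ε hε
  set r := min δ δ' / 2 with hr
  have hmin : 0 < min δ δ' := lt_min hδ hδ'
  let g : ContDiffBump y := ⟨r / 2, r, by positivity, by linarith [half_pos hmin]⟩
  have hg := h g ((Metric.closedBall_subset_ball
    (by have := min_le_left δ δ'; simp only [g]; linarith)).trans hδU)
  have hgi : Integrable (g.normed volume) := g.integrable_normed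
  have hi : Integrable fun x => a x * g.normed volume x :=
    (ha.mul g.continuous_normed).integrable_of_hasCompactSupport g.hasCompactSupport_normed.mul_left
  have h1 : |(∫ x, a x * g.normed volume x) - a y| ≤ ε := by
    have h2 : a y = ∫ x, a y * g.normed volume x := by
      rw [integral_const_mul, g.integral_normed, mul_one]
    have h3 : ε = ∫ x, ε * g.normed volume x := by
      rw [integral_const_mul, g.integral_normed, mul_one]
    rw [h2, ← integral_sub hi (hgi.const_mul _), h3, ← Real.norm_eq_abs]
    refine norm_integral_le_of_norm_le (hgi.const_mul _) (Filter.Eventually.of_forall fun x => ?_)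
    rw [← sub_mul, norm_mul, Real.norm_of_nonneg (g.nonneg_normed x)]
    by_cases hx : g.normed volume x = 0
    · simp [hx]
    · refine mul_le_mul_of_nonneg_right ?_ (g.nonneg_normed x)
      have h4 : x ∈ Metric.ball y r := by
        rw [← show Function.support (g.normed volume) = _ from g.support_normed_eq]; exact hx
      have h5 := hδa (x := x) (by
        have := Metric.mem_ball.1 h4; have := min_le_right δ δ'; linarith)
      rw [Real.dist_eq] at h5
      exact h5.le
  have := abs_sub_abs_le_abs_sub (a y) (∫ x, a x * g.normed volume x)
  rw [abs_sub_comm] at this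
  linarith

/-- Shrinking bumps give the bound at interior points; it is a closed condition and passes to the
closure of the interior. -/
theorem supComass_le_of_forall_bump {d m : ℕ} {ω : Space d → Covector d m} (hω : Continuous ω)
    {K : Set (Space d)} (hK : K ⊆ closure (interior K)) {C : ℝ≥0}
    (h : ∀ y, ∀ g : ContDiffBump y, Metric.closedBall y g.rOut ⊆ K → ∀ v : Fin m → Space d,
      |∫ x, ω x v * g.normed volume x| ≤ C * ∏ i, ‖v i‖) : supComass K ω ≤ C := by
  refine supComass_le_iff.2 fun y hy => ?_
  have hcl : IsClosed {y | ‖ω y‖ ≤ C} := isClosed_le hω.norm continuous_const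
  have hsub : interior K ⊆ {y | ‖ω y‖ ≤ C} := fun y hy =>
    ContinuousAlternatingMap.opNorm_le_bound _ C.2 fun v =>
      abs_le_of_forall_bump (continuous_apply_vec hω v) isOpen_interior hy
        fun g hg => h y g (hg.trans interior_subset) v
  have h1 : ‖ω y‖ ≤ C := closure_minimal hsub hcl (hK hy)
  rw [← ofReal_norm]
  exact (ENNReal.ofReal_le_ofReal h1).trans_eq (by simp)

theorem mass_simpleCurrent_bump_le {d m : ℕ} {y : Space d} (g : ContDiffBump y)
    (v : Fin m → Space d) :
    (simpleCurrent (g.normed volume) v).mass ≤ ENNReal.ofReal (∏ i, ‖v i‖) := by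
  refine (mass_simpleCurrent_le g.continuous_normed g.hasCompactSupport_normed v).trans_eq ?_
  simp only [abs_of_nonneg (g.nonneg_normed _), g.integral_normed, mul_one]

theorem abs_le_of_enorm_le_mul_ofReal {a b : ℝ} {C : ℝ≥0} (hb : 0 ≤ b)
    (h : ‖a‖ₑ ≤ C * ENNReal.ofReal b) : |a| ≤ C * b := by
  rw [← ofReal_norm, ← ENNReal.ofReal_coe_nnreal, ← ENNReal.ofReal_mul C.coe_nonneg,
    ENNReal.ofReal_le_ofReal_iff (by positivity)] at h
  exact h

theorem max_supComass_le {d m : ℕ} (ω : SmoothForm d m) {K : Compacts (Space d)}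
    (hK : (K : Set (Space d)) ⊆ closure (interior K)) {C : ℝ≥0}
    (hC : ∀ T ∈ normalCurrents m K, ‖T (ω.cut K)‖ₑ ≤ C * T.flatNorm) :
    max (supComass K ω.toFun) (supComass K (extDeriv ω.toFun)) ≤ C := by
  have hsupp : ∀ {y : Space d} (g : ContDiffBump y), Metric.closedBall y g.rOut ⊆ K →
      tsupport (g.normed volume) ⊆ K := fun g hg => by rwa [g.tsupport_normed_eq]
  refine max_le ?_ ?_
  · refine supComass_le_of_forall_bump ω.smooth.continuous hK fun y g hg v => ?_
    rw [← simpleCurrent_cut ω g.continuous_normed (hsupp g hg) v]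
    refine abs_le_of_enorm_le_mul_ofReal (by positivity) ((hC _ (simpleCurrent_mem
      g.contDiff_normed g.hasCompactSupport_normed (hsupp g hg) v)).trans ?_)
    gcongr
    exact (Current.flatNorm_le_mass _).trans (mass_simpleCurrent_bump_le g v)
  · refine supComass_le_of_forall_bump (contDiff_extDeriv ω.smooth).continuous hK
      fun y g hg v => ?_
    rw [← boundary_simpleCurrent_cut ω g.continuous_normed (hsupp g hg) v]
    refine abs_le_of_enorm_le_mul_ofReal (by positivity) ((hC _ (boundary_simpleCurrent_mem
      g.contDiff_normed g.hasCompactSupport_normed (hsupp g hg) v)).trans ?_)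
    gcongr
    exact (Current.flatNorm_boundary_le_mass _).trans (mass_simpleCurrent_bump_le g v)

/-! ### Currents and forms vanishing near the support -/

/-- The product of a test form with a smooth function. -/
def TestForm.smulLeft {d m : ℕ} (φ : TestForm d m) {χ : Space d → ℝ}
    (hχ : ContDiff ℝ ((⊤ : ℕ∞) : WithTop ℕ∞) χ) : TestForm d m where
  toFun x := χ x • φ x
  contDiff' := hχ.smul φ.contDiff
  hasCompactSupport' := by
    have h : HasCompactSupport φ := φ.hasCompactSupport
    refine h.mono fun x hx h0 => hx ?_
    simp only [h0, smul_zero]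
  tsupport_subset' := fun _ _ => trivial

/-- Off its support a current vanishes only locally; a partition of unity on the compact support of
`φ` glues these statements. Consequently `T` depends only on a form near `K`. -/
theorem Current.apply_eq_zero_of_eventually {d m : ℕ} {T : Current d m} {K : Set (Space d)}
    (hT : T.spt ⊆ K) {φ : TestForm d m} (h : ∀ᶠ x in 𝓝ˢ K, φ x = 0) : T φ = 0 := by
  classical
  have hdisj : ∀ x ∈ tsupport φ, x ∉ T.spt := fun x hx hxT =>
    notMem_tsupport_iff_eventuallyEq.2 (eventually_nhdsSet_iff_forall.1 h x (hT hxT)) hx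
  choose! s hs hso hxs using fun x hx => (Distribution.notMem_dsupport_iff x).1 (hdisj x hx)
  obtain ⟨t, ht, hcov⟩ := φ.hasCompactSupport.isCompact.elim_nhds_subcover s
    fun x hx => (hso x hx).mem_nhds (hxs x hx)
  obtain ⟨f, hf⟩ := SmoothPartitionOfUnity.exists_isSubordinate
    (modelWithCornersSelf ℝ (Space d)) (isClosed_tsupport φ) (fun x : t => s x)
    (fun x => hso x (ht x x.2)) (by simpa [Set.iUnion_subtype] using hcov)
  have hfs : ∀ i, ContDiff ℝ ((⊤ : ℕ∞) : WithTop ℕ∞) (f i) := fun i => (f i).contMDiff.contDiff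
  let ψ : t → TestForm d m := fun i => TestForm.smulLeft φ (hfs i)
  have hsum : φ = ∑ i, ψ i := by
    ext1 x
    have h1 : (∑ i, ψ i) x = ∑ i, ψ i x := by simp
    have h2 : ∀ i, ψ i x = f i x • φ x := fun i => rfl
    rw [h1]
    simp only [h2]
    rw [← Finset.sum_smul]
    by_cases hx : x ∈ tsupport φ
    · have h3 := f.sum_eq_one hx
      rw [finsum_eq_sum_of_fintype] at h3
      rw [h3, one_smul]
    · rw [image_eq_zero_of_notMem_tsupport hx, smul_zero]
  have hzero : ∀ i, T (ψ i) = 0 := by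
    intro i
    have h1 : Function.support (fun x => f i x • φ x) ⊆ Function.support (f i) :=
      fun x hx h0 => hx (by simp only [h0, zero_smul])
    have h2 : tsupport (fun x => f i x • φ x) ⊆ s i := Set.Subset.trans (closure_mono h1) (hf i)
    exact hs i (ht i i.2) (ψ i) h2
  rw [hsum, map_sum]
  simp only [hzero, Finset.sum_const_zero]

theorem Current.norm_apply_le_mul_mass {d m : ℕ} {T : Current d m} (hT : T.mass < ∞)
    {φ : TestForm d m} {c : ℝ} (hc : 0 < c) (h : ∀ x, ‖φ x‖ ≤ c) :
    ‖T φ‖ ≤ c * T.mass.toReal := by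
  have h1 : supComass Set.univ (c⁻¹ • φ : TestForm d m) ≤ 1 := by
    refine supComass_le_iff.2 fun x _ => ?_
    rw [← enorm_one (G := ℝ), enorm_le_iff_norm_le, norm_one]
    change ‖c⁻¹ • φ x‖ ≤ 1
    rw [norm_smul, norm_inv, Real.norm_of_nonneg hc.le, inv_mul_le_one₀ hc]
    exact h x
  have h2 : ‖T (c⁻¹ • φ)‖ₑ ≤ T.mass :=
    le_iSup₂ (f := fun (φ : TestForm d m) _ => ‖T φ‖ₑ) (c⁻¹ • φ) h1
  have h3 := ENNReal.toReal_mono hT.ne h2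
  rwa [toReal_enorm, map_smul, norm_smul, norm_inv, Real.norm_of_nonneg hc.le,
    inv_mul_le_iff₀ hc] at h3

theorem Current.norm_apply_le_mul_flatNorm {d m : ℕ} {T : Current d m} (hT : T.flatNorm < ∞)
    {φ : TestForm d m} {c : ℝ} (hc : 0 < c) (h : ∀ x, ‖φ x‖ ≤ c) (h' : ∀ x, ‖extDeriv φ x‖ ≤ c) :
    ‖T φ‖ ≤ c * T.flatNorm.toReal := by
  have h1 : max (supComass Set.univ (c⁻¹ • φ : TestForm d m))
      (supComass Set.univ (extDeriv (c⁻¹ • φ : TestForm d m))) ≤ 1 := by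
    refine max_le (supComass_le_iff.2 fun x _ => ?_) (supComass_le_iff.2 fun x _ => ?_)
    · rw [← enorm_one (G := ℝ), enorm_le_iff_norm_le, norm_one]
      change ‖c⁻¹ • φ x‖ ≤ 1
      rw [norm_smul, norm_inv, Real.norm_of_nonneg hc.le, inv_mul_le_one₀ hc]
      exact h x
    · rw [← enorm_one (G := ℝ), enorm_le_iff_norm_le, norm_one]
      change ‖extDeriv (c⁻¹ • (φ : Space d → Covector d m)) x‖ ≤ 1
      rw [extDeriv_smul, norm_smul, norm_inv, Real.norm_of_nonneg hc.le, inv_mul_le_one₀ hc]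
      exact h' x
  have h2 : ‖T (c⁻¹ • φ)‖ₑ ≤ T.flatNorm :=
    le_iSup₂ (f := fun (φ : TestForm d m) _ => ‖T φ‖ₑ) (c⁻¹ • φ) h1
  have h3 := ENNReal.toReal_mono hT.ne h2
  rwa [toReal_enorm, map_smul, norm_smul, norm_inv, Real.norm_of_nonneg hc.le,
    inv_mul_le_iff₀ hc] at h3

/-! ### Truncation of smooth forms -/

theorem exists_slow_cutoff {d : ℕ} {K : Set (Space d)} (hK : IsCompact K) {δ : ℝ} (hδ : 0 < δ) :
    ∃ χ : Space d → ℝ, ContDiff ℝ ((⊤ : ℕ∞) : WithTop ℕ∞) χ ∧ HasCompactSupport χ ∧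
      (∀ x, |χ x| ≤ 1) ∧ (∀ x, ‖fderiv ℝ χ x‖ ≤ δ) ∧ ∀ᶠ x in 𝓝ˢ K, χ x = 1 := by
  let b : ContDiffBump (0 : Space d) := ⟨1, 2, one_pos, one_lt_two⟩
  have hb : ContDiff ℝ ((⊤ : ℕ∞) : WithTop ℕ∞) b := b.contDiff
  obtain ⟨D, hD⟩ := (b.hasCompactSupport.fderiv (𝕜 := ℝ)).exists_bound_of_continuous
    (hb.continuous_fderiv (by simp))
  obtain ⟨r, hr, hKr⟩ := hK.isBounded.subset_ball_lt 0 0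
  -- Dilating the bump by `R` divides its gradient bound `D` by `R`; `R ≥ r` keeps it equal to `1`
  -- near `K`.
  set R := max r (D / δ) with hR
  have hR0 : 0 < R := hr.trans_le (le_max_left _ _)
  refine ⟨fun x => b (R⁻¹ • x), hb.comp (contDiff_const_smul _),
    b.hasCompactSupport.comp_smul (inv_ne_zero hR0.ne'), fun x => ?_, fun x => ?_, ?_⟩
  · rw [abs_of_nonneg b.nonneg]; exact b.le_one
  · have h1 : HasFDerivAt (fun x => b (R⁻¹ • x))
        ((fderiv ℝ b (R⁻¹ • x)).comp (R⁻¹ • ContinuousLinearMap.id ℝ (Space d))) x :=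
      (hb.differentiable (by simp) _).hasFDerivAt.comp x ((hasFDerivAt_id x).const_smul R⁻¹)
    rw [h1.fderiv, ContinuousLinearMap.comp_smul, norm_smul, ContinuousLinearMap.comp_id,
      norm_inv, Real.norm_of_nonneg hR0.le, inv_mul_le_iff₀ hR0]
    refine (hD _).trans ?_
    rw [← div_le_iff₀ hδ]
    exact le_max_right _ _
  · filter_upwards [Metric.isOpen_ball.mem_nhdsSet.2 hKr] with x hx
    refine b.one_of_mem_closedBall ?_
    rw [mem_closedBall_zero_iff, norm_smul, norm_inv, Real.norm_of_nonneg hR0.le]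
    change R⁻¹ * ‖x‖ ≤ 1
    rw [inv_mul_le_one₀ hR0]
    exact (mem_ball_zero_iff.1 hx).le.trans (le_max_left _ _)

theorem exists_testForm_eq_near {d m : ℕ} (ω : SmoothForm d m) {K : Set (Space d)}
    (hK : IsCompact K) {a ε : ℝ} (ha : 0 ≤ a) (hε : 0 < ε) (h : ∀ x, ‖ω.toFun x‖ ≤ a)
    (h' : ∀ x, ‖extDeriv ω.toFun x‖ ≤ a) :
    ∃ ψ : TestForm d m, (∀ᶠ x in 𝓝ˢ K, ψ x = ω.toFun x) ∧ (∀ x, ‖ψ x‖ ≤ a) ∧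
      ∀ x, ‖extDeriv ψ x‖ ≤ a + ε := by
  obtain ⟨χ, hχ, hχc, hχ1, hχ', hχK⟩ :=
    -- In `d(χω) = χ dω + dχ ∧ ω` the last term is at most `(m + 1) |dχ| a`; using `a + 1` avoids
    -- dividing by zero.
    exists_slow_cutoff hK (δ := ε / ((m + 1) * (a + 1))) (by positivity)
  let ψ : TestForm d m :=
    { toFun := fun x => χ x • ω.toFun x
      contDiff' := hχ.smul ω.smooth
      hasCompactSupport' := hχc.smul_right
      tsupport_subset' := fun _ _ => trivial }
  have hψ : (ψ : Space d → Covector d m) = fun x => χ x • ω.toFun x := rfl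
  refine ⟨ψ, ?_, fun x => ?_, fun x => ?_⟩
  · filter_upwards [hχK] with x hx
    rw [hψ]; simp [hx]
  · rw [hψ, norm_smul, Real.norm_eq_abs]
    exact (mul_le_of_le_one_left (norm_nonneg _) (hχ1 x)).trans (h x)
  · have h1 : extDeriv ψ x = χ x • extDeriv ω.toFun x +
        ContinuousAlternatingMap.alternatizeUncurryFin
          ((fderiv ℝ χ x).smulRight (ω.toFun x)) := by
      rw [hψ, extDeriv, fderiv_fun_smul (hχ.differentiable (by simp) x)
        (ω.smooth.differentiable (by simp) x),
        ContinuousAlternatingMap.alternatizeUncurryFin_add,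
        ContinuousAlternatingMap.alternatizeUncurryFin_smul]
      rfl
    rw [h1]
    refine (norm_add_le _ _).trans (add_le_add ?_ ?_)
    · rw [norm_smul, Real.norm_eq_abs]
      exact (mul_le_of_le_one_left (norm_nonneg _) (hχ1 x)).trans (h' x)
    · refine (ContinuousAlternatingMap.norm_alternatizeUncurryFin_le _).trans ?_
      rw [ContinuousLinearMap.norm_smulRight_apply]
      calc ((m : ℝ) + 1) * (‖fderiv ℝ χ x‖ * ‖ω.toFun x‖)
          ≤ (m + 1) * (ε / ((m + 1) * (a + 1)) * (a + 1)) := by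
            gcongr
            · exact hχ' x
            · linarith [h x]
        _ = ε := by field_simp

/-! ### Pulling back smooth forms -/

/-- Evaluation on tuples of basis vectors embeds covectors in a finite-dimensional space, and a
linear left inverse is continuous. -/
theorem contDiff_covector {d m : ℕ} {F : Space d → Covector d m} {n : WithTop ℕ∞}
    (h : ∀ v, ContDiff ℝ n fun x => F x v) : ContDiff ℝ n F := by
  let b := (EuclideanSpace.basisFun (Fin d) ℝ).toBasis
  let ev : Covector d m →ₗ[ℝ] ((Fin m → Fin d) → ℝ) :=
    LinearMap.pi fun s => (ContinuousAlternatingMap.apply ℝ (Space d) ℝ fun i => b (s i)).toLinearMap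
  have hinj : Function.Injective ev := fun φ ψ hφψ => by
    refine ContinuousAlternatingMap.toAlternatingMap_injective ?_
    refine AlternatingMap.coe_multilinearMap_injective ?_
    exact Module.Basis.ext_multilinear (fun _ => b) fun s => congrFun hφψ s
  obtain ⟨g, hg⟩ := ev.exists_leftInverse_of_injective (LinearMap.ker_eq_bot.2 hinj)
  have h1 : F = fun x => LinearMap.toContinuousLinearMap g (ev (F x)) := by
    funext x
    exact (LinearMap.congr_fun hg (F x)).symm
  rw [h1]
  refine (LinearMap.toContinuousLinearMap g).contDiff.comp (contDiff_pi.2 fun s => h _)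

/-- The pullback of a smooth form by a smooth map. -/
def SmoothForm.pullback {d m : ℕ} (ω : SmoothForm d m) {f : Space d → Space d}
    (hf : ContDiff ℝ ((⊤ : ℕ∞) : WithTop ℕ∞) f) : SmoothForm d m where
  toFun x := (ω.toFun (f x)).compContinuousLinearMap (fderiv ℝ f x)
  smooth := by
    refine contDiff_covector fun v => ?_
    let L : Covector d m →L[ℝ] ContinuousMultilinearMap ℝ (fun _ : Fin m => Space d) ℝ :=
      ContinuousAlternatingMap.toContinuousMultilinearMapCLM ℝ
    have h1 : ContDiff ℝ ((⊤ : ℕ∞) : WithTop ℕ∞) fun x =>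
        ContinuousMultilinearMap.compContinuousLinearMapContinuousMultilinear ℝ
          (fun _ : Fin m => Space d) (fun _ : Fin m => Space d) ℝ (fun _ => fderiv ℝ f x) :=
      (ContinuousMultilinearMap.contDiff _).comp
        (contDiff_pi.2 fun _ => hf.fderiv_right (by simp))
    have h2 : ContDiff ℝ ((⊤ : ℕ∞) : WithTop ℕ∞) fun x =>
        L (ω.toFun (f x)) := L.contDiff.comp (ω.smooth.comp hf)
    exact (ContinuousMultilinearMap.apply ℝ (fun _ : Fin m => Space d) ℝ v).contDiff.comp
      (h1.clm_apply h2)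

theorem norm_compContinuousLinearMap_le_of_norm_le_one {d m : ℕ} (φ : Covector d m)
    {L : Space d →L[ℝ] Space d} (hL : ‖L‖ ≤ 1) : ‖φ.compContinuousLinearMap L‖ ≤ ‖φ‖ :=
  (φ.norm_compContinuousLinearMap_le L).trans
    (mul_le_of_le_one_right (norm_nonneg _) (pow_le_one₀ (norm_nonneg _) hL))

theorem extDeriv_pullback_form {d m : ℕ} (ω : SmoothForm d m) {f : Space d → Space d}
    (hf : ContDiff ℝ ((⊤ : ℕ∞) : WithTop ℕ∞) f) (x : Space d) :
    extDeriv (ω.pullback hf).toFun x =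
      (extDeriv ω.toFun (f x)).compContinuousLinearMap (fderiv ℝ f x) :=
  extDeriv_pullback (ω.smooth.differentiable (by simp) _) hf.contDiffAt
    (by rw [minSmoothness_of_isRCLikeNormedField]; exact WithTop.coe_le_coe.2 (le_top (a := (2 : ℕ∞))))

/-- The pullback of a smooth form by the homothety of centre `p` and ratio `c`. -/
def SmoothForm.dilate {d m : ℕ} (ω : SmoothForm d m) (p : Space d) (c : ℝ) : SmoothForm d m where
  toFun x := c ^ m • ω.toFun (p + c • (x - p))
  smooth := by
    have h : ContDiff ℝ ((⊤ : ℕ∞) : WithTop ℕ∞) fun x => p + c • (x - p) := by fun_prop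
    exact (ω.smooth.comp h).const_smul _

theorem pullback_eventuallyEq_dilate {d m : ℕ} (ω : SmoothForm d m) {f : Space d → Space d}
    (hf : ContDiff ℝ ((⊤ : ℕ∞) : WithTop ℕ∞) f) {K : Set (Space d)} {p : Space d} {c : ℝ}
    (h : ∀ᶠ x in 𝓝ˢ K, f x = p + c • (x - p)) :
    ∀ᶠ x in 𝓝ˢ K, (ω.pullback hf).toFun x = (ω.dilate p c).toFun x := by
  filter_upwards [h.eventually_nhdsSet] with x hx
  have h1 : f =ᶠ[𝓝 x] fun x => p + c • (x - p) := hx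
  have h2 : HasFDerivAt (fun x => p + c • (x - p)) (c • ContinuousLinearMap.id ℝ (Space d)) x :=
    (((hasFDerivAt_id x).sub_const p).const_smul c).const_add p
  ext v
  change ω.toFun (f x) (fun i => fderiv ℝ f x (v i)) = c ^ m • ω.toFun (p + c • (x - p)) v
  rw [h1.fderiv_eq, h1.eq_of_nhds, h2.fderiv]
  have h3 := (ω.toFun (p + c • (x - p))).map_smul_univ (fun _ => c) v
  rw [Finset.prod_const, Finset.card_univ, Fintype.card_fin] at h3
  exact h3

/-- Joint continuity in `(c, x)` is made uniform by compactness of the support of the cutoff.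
Derivatives need not be compared, since this difference is tested against mass rather than flat
norm. -/
theorem eventually_norm_cut_sub_dilate_le {d m : ℕ} (ω : SmoothForm d m) (K : Compacts (Space d))
    (p : Space d) {ε : ℝ} (hε : 0 < ε) :
    ∀ᶠ c in 𝓝 (1 : ℝ), ∀ x, ‖(ω.cut K - (ω.dilate p c).cut K : TestForm d m) x‖ ≤ ε := by
  have h1 : ∀ c x, (ω.cut K - (ω.dilate p c).cut K : TestForm d m) x =
      cutoff K x • (ω.toFun x - c ^ m • ω.toFun (p + c • (x - p))) := fun c x => by
    rw [smul_sub]; rfl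
  have hω := ω.smooth.continuous
  have hχ := (cutoff K).continuous
  have hcont : Continuous fun q : ℝ × Space d =>
      ‖cutoff K q.2 • (ω.toFun q.2 - q.1 ^ m • ω.toFun (p + q.1 • (q.2 - p)))‖ := by
    fun_prop
  have h2 : ∀ᶠ c in 𝓝 (1 : ℝ), ∀ x ∈ tsupport (cutoff K),
      ‖cutoff K x • (ω.toFun x - c ^ m • ω.toFun (p + c • (x - p)))‖ < ε := by
    refine (cutoff K).hasCompactSupport.isCompact.eventually_forall_of_forall_eventually
      fun x _ => ?_
    refine hcont.continuousAt.eventually_lt continuousAt_const ?_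
    simpa using hε
  filter_upwards [h2] with c hc x
  rw [h1]
  by_cases hx : x ∈ tsupport (cutoff K)
  · exact (hc x hx).le
  · rw [image_eq_zero_of_notMem_tsupport hx, zero_smul, norm_zero]
    exact hε.le

/-! ### The upper bound -/

theorem norm_apply_cut_le {d m : ℕ} (ω : SmoothForm d m) {K : Compacts (Space d)}
    (hK : OpenSubsetsPos (K : Set (Space d))) (hK' : IsOneLipschitzRetract (K : Set (Space d)))
    {T : Current d m} (hT : T ∈ normalCurrents m K) {a : ℝ} (ha : 0 ≤ a)
    (h : ∀ x ∈ K, ‖ω.toFun x‖ ≤ a) (h' : ∀ x ∈ K, ‖extDeriv ω.toFun x‖ ≤ a) :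
    ‖T (ω.cut K)‖ ≤ a * T.flatNorm.toReal := by
  obtain ⟨p, hp⟩ := hK.interior_nonempty hK'.convex hK'.nonempty
  have hmass : T.mass < ∞ := (le_add_right le_rfl).trans_lt hT.1
  have hflat : T.flatNorm < ∞ := T.flatNorm_le_mass.trans_lt hmass
  -- The first `ε` comes from the slow cutoff, the second from replacing `ω` by its dilate; both are
  -- sent to `0` at the end, `T` being fixed.
  have key : ∀ ε > 0, ‖T (ω.cut K)‖ ≤ (a + ε) * T.flatNorm.toReal + ε * T.mass.toReal := by
    intro ε hε
    obtain ⟨c, ⟨hc, hc1⟩, hc0⟩ := (((eventually_norm_cut_sub_dilate_le ω K p hε).filter_mono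
      nhdsWithin_le_nhds).and (self_mem_nhdsWithin (s := Set.Iio (1 : ℝ)))).and
      (nhdsWithin_le_nhds (lt_mem_nhds (zero_lt_one (α := ℝ)))) |>.exists
    obtain ⟨f, hf, hfl, hfK, hfc⟩ := exists_smooth_contraction hK' K.isCompact hp hc0 hc1
    have hf' : ∀ x, ‖fderiv ℝ f x‖ ≤ 1 := fun x => norm_fderiv_le_of_lipschitz ℝ hfl
    obtain ⟨ψ, hψ, hψa, hψa'⟩ := exists_testForm_eq_near (ω.pullback hf) K.isCompact ha hε
      (fun x => (norm_compContinuousLinearMap_le_of_norm_le_one _ (hf' x)).trans (h _ (hfK x)))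
      (fun x => by
        rw [extDeriv_pullback_form]
        exact (norm_compContinuousLinearMap_le_of_norm_le_one _ (hf' x)).trans (h' _ (hfK x)))
    have h1 : T ((ω.dilate p c).cut K - ψ) = 0 := by
      refine Current.apply_eq_zero_of_eventually hT.2 ?_
      filter_upwards [hψ, pullback_eventuallyEq_dilate ω hf hfc,
        (ω.dilate p c).cut_eventuallyEq K] with x h1 h2 h3
      change (ω.dilate p c).cut K x - ψ x = 0
      rw [h1, h2, h3, sub_self]
    have h2 : T (ω.cut K) = T ψ + T (ω.cut K - (ω.dilate p c).cut K) := by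
      rw [map_sub] at h1 ⊢
      linarith
    rw [h2]
    refine (norm_add_le _ _).trans (add_le_add ?_ ?_)
    · exact Current.norm_apply_le_mul_flatNorm hflat (by positivity)
        (fun x => (hψa x).trans (by linarith)) hψa'
    · exact Current.norm_apply_le_mul_mass hmass hε hc
  have hlim : Filter.Tendsto
      (fun ε : ℝ => (a + ε) * T.flatNorm.toReal + ε * T.mass.toReal) (𝓝[>] 0)
      (𝓝 (a * T.flatNorm.toReal)) := by
    have : Continuous fun ε : ℝ => (a + ε) * T.flatNorm.toReal + ε * T.mass.toReal := by fun_prop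
    have h0 := (this.tendsto 0).mono_left (nhdsWithin_le_nhds (s := Set.Ioi 0))
    simpa using h0
  exact ge_of_tendsto hlim (eventually_nhdsWithin_of_forall key)

/-! ### The fractional norm with exponent one -/

theorem supComass_lt_top {d m : ℕ} {ω : Space d → Covector d m} (hω : Continuous ω)
    {K : Set (Space d)} (hK : IsCompact K) : supComass K ω < ∞ := by
  obtain ⟨C, hC⟩ := hK.exists_bound_of_continuousOn hω.continuousOn
  refine (supComass_le_iff.2 fun y hy => ?_).trans_lt (ENNReal.ofReal_lt_top (r := C))
  rw [← ofReal_norm]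
  exact ENNReal.ofReal_le_ofReal (hC y hy)

theorem fracNorm_one_charge {d m : ℕ} (ω : SmoothForm d m) {K : Compacts (Space d)}
    (hK : OpenSubsetsPos (K : Set (Space d))) (hK' : IsOneLipschitzRetract (K : Set (Space d))) :
    fracNorm 1 (ω.charge K) =
      max (supComass K ω.toFun) (supComass K (extDeriv ω.toFun)) := by
  have hfin : max (supComass K ω.toFun) (supComass K (extDeriv ω.toFun)) < ∞ :=
    max_lt (supComass_lt_top ω.smooth.continuous K.isCompact)
      (supComass_lt_top (contDiff_extDeriv ω.smooth).continuous K.isCompact)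
  have hcl : (K : Set (Space d)) ⊆ closure (interior K) := by
    rw [hK'.convex.closure_interior_eq_closure_of_nonempty_interior
      (hK.interior_nonempty hK'.convex hK'.nonempty)]
    exact subset_closure
  -- With `α = 1` the normal mass enters to the power `0`, which is `1` in `ℝ≥0∞` for every base.
  have hiff : ∀ C : ℝ≥0, (∀ T : normalCurrents m K,
      ‖ω.charge K T‖ₑ ≤ C * T.1.normalMass ^ (1 - (1 : ℝ)) * T.1.flatNorm ^ (1 : ℝ)) ↔
      ∀ T ∈ normalCurrents m K, ‖T (ω.cut K)‖ₑ ≤ C * T.flatNorm := fun C => by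
    simp only [sub_self, ENNReal.rpow_zero, mul_one, ENNReal.rpow_one, Subtype.forall]
    rfl
  refine le_antisymm ?_ (le_iInf₂ fun C hC => max_supComass_le ω hcl ((hiff C).1 hC))
  set M := max (supComass K ω.toFun) (supComass K (extDeriv ω.toFun)) with hM
  rw [← ENNReal.coe_toNNReal hfin.ne]
  refine iInf₂_le M.toNNReal ((hiff _).2 fun T hT => ?_)
  have hflat : T.flatNorm < ∞ :=
    T.flatNorm_le_mass.trans_lt ((le_add_right le_rfl).trans_lt hT.1)
  have h := norm_apply_cut_le ω hK hK' hT (a := M.toReal) ENNReal.toReal_nonneg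
    (fun x hx => by
      rw [← toReal_enorm]
      exact ENNReal.toReal_mono hfin.ne ((enorm_le_supComass hx).trans (le_max_left _ _)))
    (fun x hx => by
      rw [← toReal_enorm]
      exact ENNReal.toReal_mono hfin.ne ((enorm_le_supComass hx).trans (le_max_right _ _)))
  rw [← ofReal_norm]
  refine (ENNReal.ofReal_le_ofReal h).trans_eq ?_
  rw [ENNReal.ofReal_mul ENNReal.toReal_nonneg, ENNReal.ofReal_toReal hfin.ne,
    ENNReal.ofReal_toReal hflat.ne, ENNReal.coe_toNNReal hfin.ne]

/-! ### Wedge products of smooth forms. -/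

/-- The product rule splits the full derivative of `ω ∧ η` into two pieces; after alternatization
each is controlled by one exterior derivative. -/
theorem norm_extDeriv_wedge_le {d m n : ℕ} (ω : SmoothForm d m) (η : SmoothForm d n)
    (x : Space d) :
    ‖extDeriv (ω.wedge η).toFun x‖ ≤ (m + n + 1).factorial *
      (‖ω.toFun x‖ * ‖extDeriv η.toFun x‖ + ‖extDeriv ω.toFun x‖ * ‖η.toFun x‖) := by
  have h1 : fderiv ℝ (ω.wedge η).toFun x =
      (wedgeCLM d m n).precompR (Space d) (ω.toFun x) (fderiv ℝ η.toFun x) +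
        (wedgeCLM d m n).precompL (Space d) (fderiv ℝ ω.toFun x) (η.toFun x) :=
    (wedgeCLM d m n).fderiv_of_bilinear (ω.smooth.differentiable (by simp) x)
      (η.smooth.differentiable (by simp) x)
  rw [extDeriv, h1, ContinuousAlternatingMap.alternatizeUncurryFin_add, mul_add]
  refine (norm_add_le _ _).trans (add_le_add ?_ ?_)
  · exact norm_alternatizeUncurryFin_wedge_right_le _ (fderiv ℝ η.toFun x) fun v => rfl
  · exact norm_alternatizeUncurryFin_wedge_left_le (fderiv ℝ ω.toFun x) _ fun v => rfl

theorem max_supComass_wedge_le {d m n : ℕ} (ω : SmoothForm d m) (η : SmoothForm d n)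
    {K : Set (Space d)} (hK : IsCompact K) :
    max (supComass K (ω.wedge η).toFun) (supComass K (extDeriv (ω.wedge η).toFun)) ≤
      ((Fintype.card (Equiv.Perm.ModSumCongr (Fin m) (Fin n)) + 2 * (m + n + 1).factorial : ℕ) :
          ℝ≥0) *
        max (supComass K ω.toFun) (supComass K (extDeriv ω.toFun)) *
        max (supComass K η.toFun) (supComass K (extDeriv η.toFun)) := by
  -- `N`, the number of shuffles, handles `ω ∧ η`; the summand `2 (m + n + 1)!` handles the two
  -- terms of `d(ω ∧ η)`.
  set N := Fintype.card (Equiv.Perm.ModSumCongr (Fin m) (Fin n))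
  have hfin : ∀ {k : ℕ} (ω : SmoothForm d k),
      max (supComass K ω.toFun) (supComass K (extDeriv ω.toFun)) < ∞ := fun ω =>
    max_lt (supComass_lt_top ω.smooth.continuous hK)
      (supComass_lt_top (contDiff_extDeriv ω.smooth).continuous hK)
  have hb : ∀ {k : ℕ} (ω : SmoothForm d k), ∀ x ∈ K,
      ‖ω.toFun x‖ ≤ (max (supComass K ω.toFun) (supComass K (extDeriv ω.toFun))).toReal ∧
      ‖extDeriv ω.toFun x‖ ≤
        (max (supComass K ω.toFun) (supComass K (extDeriv ω.toFun))).toReal := fun ω x hx => by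
    constructor <;> rw [← toReal_enorm] <;> refine ENNReal.toReal_mono (hfin ω).ne ?_
    · exact (enorm_le_supComass hx).trans (le_max_left _ _)
    · exact (enorm_le_supComass hx).trans (le_max_right _ _)
  have hω := hb ω
  have hη := hb η
  have hωfin := hfin ω
  have hηfin := hfin η
  set A := max (supComass K ω.toFun) (supComass K (extDeriv ω.toFun))
  set B := max (supComass K η.toFun) (supComass K (extDeriv η.toFun))
  have hA0 : 0 ≤ A.toReal := ENNReal.toReal_nonneg
  have hB0 : 0 ≤ B.toReal := ENNReal.toReal_nonneg
  have hF : (0 : ℝ) ≤ (m + n + 1).factorial := by positivity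
  have hN : (0 : ℝ) ≤ N := by positivity
  have hAB : 0 ≤ A.toReal * B.toReal := by positivity
  have hrhs : (((N + 2 * (m + n + 1).factorial : ℕ) : ℝ≥0) : ℝ≥0∞) * A * B =
      ENNReal.ofReal ((N + 2 * (m + n + 1).factorial : ℝ) * (A.toReal * B.toReal)) := by
    rw [ENNReal.ofReal_mul (by positivity), ENNReal.ofReal_mul hA0,
      ENNReal.ofReal_toReal hωfin.ne, ENNReal.ofReal_toReal hηfin.ne, ← mul_assoc]
    congr 2
    rw [← ENNReal.ofReal_coe_nnreal]
    congr 1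
    push_cast
    rfl
  rw [hrhs]
  refine max_le (supComass_le_iff.2 fun x hx => ?_) (supComass_le_iff.2 fun x hx => ?_)
  · rw [← ofReal_norm]
    refine ENNReal.ofReal_le_ofReal ?_
    calc ‖(ω.wedge η).toFun x‖ ≤ N * ‖ω.toFun x‖ * ‖η.toFun x‖ := norm_wedge_le _ _
      _ ≤ N * A.toReal * B.toReal := by
        gcongr
        exacts [(hω x hx).1, (hη x hx).1]
      _ ≤ _ := by nlinarith [mul_nonneg hF hAB]
  · rw [← ofReal_norm]
    refine ENNReal.ofReal_le_ofReal ?_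
    calc ‖extDeriv (ω.wedge η).toFun x‖ ≤ _ := norm_extDeriv_wedge_le ω η x
      _ ≤ (m + n + 1).factorial * (A.toReal * B.toReal + A.toReal * B.toReal) := by
        gcongr
        exacts [(hω x hx).1, (hη x hx).2, (hω x hx).2, (hη x hx).1]
      _ ≤ _ := by nlinarith [mul_nonneg hN hAB]

end FracCharge

end

theorem proposition4p7 (d : ℕ) (hd : 1 ≤ d) :
    (∀ (m : ℕ) (ω : FracCharge.SmoothForm d m) (K : TopologicalSpace.Compacts (FracCharge.Space d)),
      FracCharge.OpenSubsetsPos (K : Set (FracCharge.Space d)) →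
      FracCharge.IsOneLipschitzRetract (K : Set (FracCharge.Space d)) →
      FracCharge.fracNorm 1 (ω.charge K) =
        max (FracCharge.supComass K ω.toFun) (FracCharge.supComass K (extDeriv ω.toFun))) ∧
    (∀ m m' : ℕ, ∃ C : ℝ≥0,
      ∀ (ω : FracCharge.SmoothForm d m) (η : FracCharge.SmoothForm d m')
        (K : TopologicalSpace.Compacts (FracCharge.Space d)),
        FracCharge.OpenSubsetsPos (K : Set (FracCharge.Space d)) →
        FracCharge.IsOneLipschitzRetract (K : Set (FracCharge.Space d)) →
        FracCharge.fracNorm 1 ((ω.wedge η).charge K) ≤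
          C * FracCharge.fracNorm 1 (ω.charge K) * FracCharge.fracNorm 1 (η.charge K)) := by
  refine ⟨fun m ω K hK hK' => FracCharge.fracNorm_one_charge ω hK hK', fun m m' =>
    ⟨(Fintype.card (Equiv.Perm.ModSumCongr (Fin m) (Fin m')) + 2 * (m + m' + 1).factorial : ℕ),
      fun ω η K hK hK' => ?_⟩⟩
  rw [FracCharge.fracNorm_one_charge _ hK hK', FracCharge.fracNorm_one_charge _ hK hK',
    FracCharge.fracNorm_one_charge _ hK hK']
  exact FracCharge.max_supComass_wedge_le ω η K.isCompact
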